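/- **Setting.** Let $d\in\mathbb N$, $|\mathbf k|=\max_v|k_v|$ and $\langle\mathbf k\rangle=\max\{1,|\mathbf k|\}$ for $\mathbf k\in\mathbb Z^d$, and $(\sigma_{\mathbf j}a)_{\mathbf i}=a_{\mathbf i-\mathbf j}$. A *translation invariant Banach algebra* $(\mathfrak B,\|\cdot\|_{\mathfrak B})$ is a Banach algebra of complex sequences $(a_{\mathbf i})_{\mathbf i\in\mathbb Z^d}$ with pointwise operations that contains the constant sequence $1$, with $\|1\|_{\mathfrak B}=1$, and satisfies $\sigma_{\mathbf j}a\in\mathfrak B$, $\|\sigma_{\mathbf j}a\|_{\mathfrak B}=\|a\|_{\mathfrak B}$ for all $a\in\mathfrak B$, $\mathbf j\in\mathbb Z^d$. A diagonal matrix $D=\mathrm{diag}(d_{\mathbf i})$ belongs to $DC_{\mathfrak B}(\tau,\gamma)$ if for every $\mathbf k\ne\mathbf 0$ all the numbers $d_{\mathbf i}-d_{\mathbf i-\mathbf k}$ are nonzero and the sequence $\big((d_{\mathbf i}-d_{\mathbf i-\mathbf k})^{-1}\big)_{\mathbf i}$ is in $\mathfrak B$ with norm at most $\gamma^{-1}|\mathbf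 k|^{\tau}$ ($D$ itself may be unbounded). For an infinite matrix $A=(a_{\mathbf i,\mathbf j})_{\mathbf i,\mathbf j\in\mathbb Z^d}$ put $A_{\mathbf k}=(a_{\mathbf i,\mathbf i-\mathbf k})_{\mathbf i}$; for $s\ge 0$, $\mathcal M^s$ is the set of those $A$ with all $A_{\mathbf k}\in\mathfrak B$ and $\|A\|_s^2=\sum_{\mathbf k}\|A_{\mathbf k}\|_{\mathfrak B}^2\langle\mathbf k\rangle^{2s}<\infty$, and $\mathcal M_0^\infty$ is the set of diagonal matrices in $\bigcap_{s\ge 0}\mathcal M^s$. **Theorem.** Let $\delta>0$, $\alpha_0>d/2$, $\tau>0$ and $\alpha>\alpha_0+\tau+7\delta$. There is $C=C(d,\delta,\tau,\alpha_0,\alpha)>0$, and for every $\gamma>0$ there is $\epsilon_0=\epsilon_0(d,\delta,\tau,\gamma,\alpha_0,\alpha)>0$, such that for every translation invariant Banach algebra $\mathfrak B$, every $D\in DC_{\mathfrak B}(\tau,\gamma)$ and every $T\in\mathcal M^{\alpha+4\delta}$ with $\|T\|_{\alpha+4\delta}\le\epsilon_0$ the following holds. There are $Q_+\in\mathcal M^{\alpha-\tau-7\delta}$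 with an inverse $Q_+^{-1}\in\mathcal M^{\alpha-\tau-7\delta}$ and $D_+\in\mathcal M_0^\infty$ such that $$Q_+^{-1}(T+D+D_+)Q_+=D$$ (as infinite matrices, all the entries of the product being absolutely convergent series), with $$\|Q_+-I\|_{\alpha-\tau-7\delta}\le C\|T\|_{\alpha+4\delta}^{\frac{\delta}{\alpha-\alpha_0}},\qquad \|Q_+^{-1}-I\|_{\alpha-\tau-7\delta}\le C\|T\|_{\alpha+4\delta}^{\frac{\delta}{\alpha-\alpha_0}},\qquad \|D_+\|_0\le C\|T\|_{\alpha+4\delta},$$ and, if $\alpha-\alpha_0\ge 1$, also $\|D_+\|_0\le C\|T\|_{\alpha+4\delta}^{\frac1{\alpha-\alpha_0}}$. Moreover, if $T$ and $D$ are both real symmetric, then the matrix $U=Q_+(Q_+^tQ_+)^{-1/2}$, with $Q_+^t$ the transpose of $Q_+$ and $(Q_+^tQ_+)^{-1/2}\in\mathcal M^{\alpha-\tau-7\delta}$ the positive inverse square root, is well defined, belongs to $\mathcal M^{\alpha-\tau-7\delta}$, is unitary, and satisfies $$U^{-1}(T+D+D_+)U=D,\qquad \|U-I\|_{\alpha-\tau-7\delta}\le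 C\|T\|_{\alpha+4\delta}^{\frac{\delta}{\alpha-\alpha_0}}.$$ -/

import Mathlib

open scoped Matrix ComplexOrder
open Filter Topology

/-- The lattice `ℤ^d`; the norm `‖k‖` that Mathlib puts on it is the sup norm
`max_v |k_v|`. -/
abbrev Zd (d : ℕ) : Type := Fin d → ℤ

/-- Infinite complex matrices indexed by `ℤ^d`. -/
abbrev InfMat (d : ℕ) : Type := Matrix (Zd d) (Zd d) ℂ

/-- The translation `(σ_j a)_i = a_{i - j}`. -/
def shift {d : ℕ} (j : Zd d) (a : Zd d → ℂ) : Zd d → ℂ := fun i => a (i - j)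

/-- A translation invariant Banach algebra of complex sequences indexed by `ℤ^d`, with pointwise
operations: it contains the constant sequence `1`, which has norm `1`; its norm is a complete
submultiplicative algebra norm; translations act on it isometrically. -/
structure TIBanachAlgebra (d : ℕ) where
  /-- the set of sequences, a unital subalgebra of all sequences -/
  carrier : Subalgebra ℂ (Zd d → ℂ)
  /-- the norm (definite, homogeneous, subadditive, submultiplicative) -/
  norm' : AlgebraNorm ℂ carrier
  norm_one' : norm' 1 = 1
  complete' : ∀ u : ℕ → carrier,
    (∀ ε : ℝ, 0 < ε → ∃ N : ℕ, ∀ m ≥ N, ∀ n ≥ N, norm' (u m - u n) < ε) →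
    ∃ a : carrier, Tendsto (fun n => norm' (u n - a)) atTop (𝓝 0)
  shift_mem' : ∀ (j : Zd d) (a : carrier), shift j (a : Zd d → ℂ) ∈ carrier
  norm_shift' : ∀ (j : Zd d) (a : carrier), norm' ⟨shift j a, shift_mem' j a⟩ = norm' a

open Classical in
/-- The norm `‖a‖_𝔅` of a sequence `a ∈ 𝔅`, as a function of the sequence
(it is only used for `a ∈ 𝔅`; elsewhere it has the value `0`). -/
noncomputable def TIBanachAlgebra.seqNorm {d : ℕ} (B : TIBanachAlgebra d) (a : Zd d → ℂ) : ℝ :=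
  if h : a ∈ B.carrier then B.norm' ⟨a, h⟩ else 0

/-- `p` is a `(τ, γ)`-distal sequence for `𝔅`: for every `k ≠ 0` the sequence `p - σ_k p` has no
zero entry, and its pointwise inverse lies in `𝔅` with norm at most `γ⁻¹ |k|^τ`. -/
def IsDistal {d : ℕ} (B : TIBanachAlgebra d) (τ γ : ℝ) (p : Zd d → ℂ) : Prop :=
  ∀ k : Zd d, k ≠ 0 →
    (∀ i, p i - shift k p i ≠ 0) ∧
    (fun i => (p i - shift k p i)⁻¹) ∈ B.carrier ∧
    B.seqNorm (fun i => (p i - shift k p i)⁻¹) ≤ γ⁻¹ * ‖k‖ ^ τ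

/-- The `k`-diagonal `A_k = (a_{i, i - k})_i`. -/
def kDiag {d : ℕ} (A : InfMat d) (k : Zd d) : Zd d → ℂ := fun i => A i (i - k)

/-- `⟨k⟩ = max {1, |k|}`. -/
noncomputable def bracket {d : ℕ} (k : Zd d) : ℝ := max 1 ‖k‖

/-- The Sobolev type norm `‖A‖_s = (∑_k ‖A_k‖_𝔅² ⟨k⟩^{2s})^{1/2}`, meaningful on `𝓜^s`. -/
noncomputable def sobNorm {d : ℕ} (B : TIBanachAlgebra d) (s : ℝ) (A : InfMat d) : ℝ :=
  Real.sqrt (∑' k : Zd d, B.seqNorm (kDiag A k) ^ 2 * bracket k ^ (2 * s))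

/-- The space `𝓜^s`: all diagonals of `A` lie in `𝔅`, and `‖A‖_s < ∞`. -/
def MSpace {d : ℕ} (B : TIBanachAlgebra d) (s : ℝ) : Set (InfMat d) :=
  {A | (∀ k, kDiag A k ∈ B.carrier) ∧
    Summable fun k : Zd d => B.seqNorm (kDiag A k) ^ 2 * bracket k ^ (2 * s)}

/-- The space `𝓜_0^∞` of the diagonal matrices in `𝓜^∞ = ⋂_{s ≥ 0} 𝓜^s`. -/
def MDiag {d : ℕ} (B : TIBanachAlgebra d) : Set (InfMat d) :=
  {A | (∀ s : ℝ, 0 ≤ s → A ∈ MSpace B s) ∧ A.IsDiag}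

/-- `A B = C` for infinite matrices, every entry of the product being an absolutely convergent
series. -/
def IsMatProd {d : ℕ} (A B C : InfMat d) : Prop :=
  ∀ i j, HasSum (fun k => A i k * B k j) (C i j)

/-- `A B C = E` for infinite matrices, every entry of the triple product being an absolutely
convergent double series (so that the way of inserting brackets does not matter). -/
def IsMatProd₃ {d : ℕ} (A B C E : InfMat d) : Prop :=
  ∀ i j, HasSum (fun kl : Zd d × Zd d => A i kl.1 * B kl.1 kl.2 * C kl.2 j) (E i j)

/-- `P` is the two-sided inverse of `Q`. -/
def IsMatInv {d : ℕ} (Q P : InfMat d) : Prop := IsMatProd P Q 1 ∧ IsMatProd Q P 1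

/-- `R = G^{-1/2}`: `R` is positive semidefinite and `R²` is the inverse of `G`. (It determines `R`
among the matrices of bounded operators on `ℓ²(ℤ^d)`, and so among those in `𝓜^s`,
`s > d/2`.) -/
def IsInvSqrt {d : ℕ} (G R : InfMat d) : Prop :=
  R.PosSemidef ∧ ∃ S : InfMat d, IsMatProd R R S ∧ IsMatInv G S

/-- `U` is unitary: `U* U = U U* = 1`. -/
def IsUnitaryMat {d : ℕ} (U : InfMat d) : Prop := IsMatInv U Uᴴ

/-- `A` is real symmetric. -/
def IsRealSymm {d : ℕ} (A : InfMat d) : Prop := (∀ i j, (A i j).im = 0) ∧ A.IsSymm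

/-! The proof is a Newton scheme run at a fixed geometric rate. All matrices except `D` live in the
Banach algebra `WienerAlg` of matrices with norm-summable diagonals. The unbounded `D` enters only
through entrywise commutators (`IsComm`), which obey the Leibniz rule and pass to limits.

Suppose `Q`, with inverse `P`, conjugates `D + T + diag X` to `D + E`. Adding `y = -E 0` to `X`
replaces `E` by `F = E + P diag(y) Q`, whose main diagonal is small compared with `E` because `Q`
and `P` are close to `1`. Distality allows one to solve `[D, V] = -F` on the diagonals `0 < |k| ≤
N`, at the price of a factor `γ⁻¹ N^τ`. Conjugation by `1 + V` then leaves the error `(1 + V)⁻¹ (F -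
trunc N F + F V)` (`IsConj.step`). Its three sources are the tail `|k| > N`, the residual main
diagonal and a quadratic term.

Instead of smoothing estimates in several norms, the `n`-th error is measured in the single weight
`⟨k⟩^α₀ + θ^n ⟨k⟩^β`, with `β = α + 4δ` and `N_n = Λ^(n+1)`. Passing to the next weight gains `2θ`
beyond `N_n` (`scaleWeight_tail`), so the error decays like `q^n` with `q = Λ^(-(α - α₀))`. In the
norm of order `α - τ - 7δ` the corrections decay like `Λ^(-7δn)`, hence `Q` and `P` converge with
bounds linear in `‖T‖` (`exists_conj`). The constant there depends on `γ`; smallness of `‖T‖` trades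
it for the fractional power in the theorem.

In the real symmetric case `Q` is real and `QᵗQ` commutes with `D`. Distality makes it diagonal, so
its inverse square root is found in the commutative algebra of sequences (`exists_inv_sqrt`,
`IsConj.exists_polar`). -/

/-- The sequences of a translation invariant Banach algebra, as a type. -/
def TIBanachAlgebra.Seq {d : ℕ} (B : TIBanachAlgebra d) : Type := B.carrier

/-! ### Sequences as a commutative complex Banach algebra -/

namespace TIBanachAlgebra.Seq

variable {d : ℕ} {B : TIBanachAlgebra d}

noncomputable instance : CommRing B.Seq := inferInstanceAs (CommRing B.carrier)

noncomputable instance : Algebra ℂ B.Seq := inferInstanceAs (Algebra ℂ B.carrier)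

noncomputable instance : NormedCommRing B.Seq :=
  { RingNorm.toNormedRing (R := B.Seq) B.norm'.toRingNorm with mul_comm := mul_comm }

noncomputable instance : NormedAlgebra ℂ B.Seq where
  norm_smul_le c a := (map_smul_eq_mul B.norm' c a).le

instance : NormOneClass B.Seq := ⟨B.norm_one'⟩

instance : CompleteSpace B.Seq := by
  refine Metric.complete_of_cauchySeq_tendsto fun u hu => ?_
  obtain ⟨a, ha⟩ := B.complete' u fun ε hε => by
    obtain ⟨N, hN⟩ := Metric.cauchySeq_iff.1 hu ε hε
    exact ⟨N, fun m hm n hn => by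
      have h := hN m hm n hn
      rw [dist_eq_norm] at h
      exact h⟩
  refine ⟨a, tendsto_iff_norm_sub_tendsto_zero.2 ha⟩

instance : FunLike B.Seq (Zd d) ℂ where
  coe a := a.1
  coe_injective _ _ h := Subtype.ext h

theorem ext {a b : B.Seq} (h : ∀ i, a i = b i) : a = b := DFunLike.ext _ _ h

@[simp] theorem add_apply (a b : B.Seq) (i : Zd d) : (a + b) i = a i + b i := rfl
@[simp] theorem sub_apply (a b : B.Seq) (i : Zd d) : (a - b) i = a i - b i := rfl
@[simp] theorem neg_apply (a : B.Seq) (i : Zd d) : (-a) i = -a i := rfl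
@[simp] theorem mul_apply (a b : B.Seq) (i : Zd d) : (a * b) i = a i * b i := rfl
@[simp] theorem zero_apply (i : Zd d) : (0 : B.Seq) i = 0 := rfl
@[simp] theorem one_apply (i : Zd d) : (1 : B.Seq) i = 1 := rfl

/-- Evaluation at a lattice point. -/
noncomputable def evalHom (i : Zd d) : B.Seq →ₐ[ℂ] ℂ :=
  ((Pi.evalAlgHom ℂ (fun _ : Zd d => ℂ) i).comp B.carrier.val : B.carrier →ₐ[ℂ] ℂ)

@[simp] theorem evalHom_apply (i : Zd d) (a : B.Seq) : evalHom i a = a i := rfl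

/-- Evaluation at a point is a character, and characters of a complex Banach algebra with `‖1‖ = 1`
are contractive. This is the only link between the abstract norm and the entries. -/
theorem norm_apply_le (a : B.Seq) (i : Zd d) : ‖a i‖ ≤ ‖a‖ :=
  AlgHom.norm_apply_le_self (evalHom i) a

theorem continuous_apply (i : Zd d) : Continuous fun a : B.Seq => a i := by
  refine (LipschitzWith.of_dist_le_mul (K := 1) fun a b => ?_).continuous
  simpa [dist_eq_norm] using norm_apply_le (a - b) i

/-- Translation as a ring homomorphism. -/
noncomputable def shiftHom (j : Zd d) : B.Seq →+* B.Seq where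
  toFun a := ⟨shift j a, B.shift_mem' j a⟩
  map_one' := rfl
  map_mul' _ _ := rfl
  map_zero' := rfl
  map_add' _ _ := rfl

@[simp] theorem shiftHom_apply (j : Zd d) (a : B.Seq) (i : Zd d) : shiftHom j a i = a (i - j) := rfl

@[simp] theorem norm_shiftHom (j : Zd d) (a : B.Seq) : ‖shiftHom j a‖ = ‖a‖ := B.norm_shift' j a

end TIBanachAlgebra.Seq

/-! ### The Banach algebra of matrices with summable diagonals -/

open TIBanachAlgebra

/-- The matrices whose diagonals lie in the Banach algebra and have summable norms; such a matrix
is given by the family of its diagonals. -/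
def WienerAlg {d : ℕ} (B : TIBanachAlgebra d) : Type := lp (fun _ : Zd d => B.Seq) 1

namespace WienerAlg

variable {d : ℕ} {B : TIBanachAlgebra d}

noncomputable instance : NormedAddCommGroup (WienerAlg B) :=
  inferInstanceAs (NormedAddCommGroup (lp (fun _ : Zd d => B.Seq) 1))

instance : CompleteSpace (WienerAlg B) :=
  inferInstanceAs (CompleteSpace (lp (fun _ : Zd d => B.Seq) 1))

instance : FunLike (WienerAlg B) (Zd d) B.Seq where
  coe A := (A : lp (fun _ : Zd d => B.Seq) 1).1
  coe_injective _ _ h := Subtype.ext h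

theorem ext {A A' : WienerAlg B} (h : ∀ k, A k = A' k) : A = A' := DFunLike.ext _ _ h

@[simp] theorem add_apply (A A' : WienerAlg B) (k : Zd d) : (A + A') k = A k + A' k := rfl
@[simp] theorem sub_apply (A A' : WienerAlg B) (k : Zd d) : (A - A') k = A k - A' k := rfl
@[simp] theorem neg_apply (A : WienerAlg B) (k : Zd d) : (-A) k = -A k := rfl
@[simp] theorem zero_apply (k : Zd d) : (0 : WienerAlg B) k = 0 := rfl

theorem hasSum_norm (A : WienerAlg B) : HasSum (fun k => ‖A k‖) ‖A‖ := by
  have h := lp.hasSum_norm (p := 1) (by simp) (A : lp (fun _ : Zd d => B.Seq) 1)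
  simp only [ENNReal.toReal_one, Real.rpow_one] at h
  exact h

theorem summable_norm (A : WienerAlg B) : Summable fun k => ‖A k‖ := A.hasSum_norm.summable

theorem norm_apply_le (A : WienerAlg B) (k : Zd d) : ‖A k‖ ≤ ‖A‖ :=
  le_hasSum A.hasSum_norm k fun _ _ => norm_nonneg _

theorem continuous_apply (k : Zd d) : Continuous fun A : WienerAlg B => A k := by
  refine (LipschitzWith.of_dist_le_mul (K := 1) fun A A' => ?_).continuous
  simpa [dist_eq_norm] using norm_apply_le (A - A') k

/-- The matrix with given summable diagonals. -/
noncomputable def ofDiags (f : Zd d → B.Seq) (h : Summable fun k => ‖f k‖) : WienerAlg B :=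
  (⟨f, memℓp_gen (by simpa using h)⟩ : lp (fun _ : Zd d => B.Seq) 1)

@[simp] theorem ofDiags_apply (f : Zd d → B.Seq) (h : Summable fun k => ‖f k‖) (k : Zd d) :
    ofDiags f h k = f k := rfl

theorem norm_le_of_sum_le (A : WienerAlg B) {x : ℝ} (h : ∀ s : Finset (Zd d), ∑ k ∈ s, ‖A k‖ ≤ x) :
    ‖A‖ ≤ x := by
  rw [← A.hasSum_norm.tsum_eq]
  exact A.summable_norm.tsum_le_of_sum_le h

/-- The entries of the matrix. -/
def mat (A : WienerAlg B) : InfMat d := fun i j => A (i - j) i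

theorem mat_apply (A : WienerAlg B) (i j : Zd d) : mat A i j = A (i - j) i := rfl

theorem apply_eq_mat (A : WienerAlg B) (k i : Zd d) : A k i = mat A i (i - k) := by
  simp [mat_apply]

theorem mat_injective : Function.Injective (mat : WienerAlg B → InfMat d) := fun A A' h =>
  ext fun k => Seq.ext fun i => by rw [apply_eq_mat, apply_eq_mat, h]

@[simp] theorem mat_add (A A' : WienerAlg B) : mat (A + A') = mat A + mat A' := rfl
@[simp] theorem mat_sub (A A' : WienerAlg B) : mat (A - A') = mat A - mat A' := rfl
@[simp] theorem mat_neg (A : WienerAlg B) : mat (-A) = -mat A := rfl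
@[simp] theorem mat_zero : mat (0 : WienerAlg B) = 0 := rfl

theorem norm_mat_le (A : WienerAlg B) (i j : Zd d) : ‖mat A i j‖ ≤ ‖A (i - j)‖ :=
  Seq.norm_apply_le _ _

theorem norm_mat_le_norm (A : WienerAlg B) (i j : Zd d) : ‖mat A i j‖ ≤ ‖A‖ :=
  (norm_mat_le A i j).trans (norm_apply_le A _)

theorem summable_norm_row (A : WienerAlg B) (i : Zd d) : Summable fun j => ‖mat A i j‖ := by
  refine .of_nonneg_of_le (fun _ => norm_nonneg _) (norm_mat_le A i) ?_
  simpa [Function.comp_def] using (Equiv.subLeft i).summable_iff.2 A.summable_norm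

theorem summable_norm_col (A : WienerAlg B) (j : Zd d) : Summable fun i => ‖mat A i j‖ := by
  refine .of_nonneg_of_le (fun _ => norm_nonneg _) (fun i => norm_mat_le A i j) ?_
  simpa [Function.comp_def] using (Equiv.subRight j).summable_iff.2 A.summable_norm

theorem summable_mul_prod (A A' : WienerAlg B) :
    Summable fun x : Zd d × Zd d => ‖A x.1‖ * ‖A' (x.2 - x.1)‖ := by
  have h := A.summable_norm.mul_of_nonneg A'.summable_norm (fun _ => norm_nonneg _)
    (fun _ => norm_nonneg _)
  let e : Zd d × Zd d ≃ Zd d × Zd d :=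
    { toFun := fun x => (x.1, x.2 - x.1)
      invFun := fun x => (x.1, x.2 + x.1)
      left_inv := fun x => by simp
      right_inv := fun x => by simp }
  simpa [e, Function.comp_def] using e.summable_iff.2 h

theorem summable_mul_prod_symm (A A' : WienerAlg B) :
    Summable fun x : Zd d × Zd d => ‖A x.2‖ * ‖A' (x.1 - x.2)‖ := by
  simpa [Function.comp_def] using
    (Equiv.prodComm _ _).summable_iff.2 (summable_mul_prod A A')

theorem summable_mul_norm_fiber (A A' : WienerAlg B) (k : Zd d) :
    Summable fun l => ‖A l‖ * ‖A' (k - l)‖ := by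
  have h := (summable_mul_prod_symm A A').prod_factor k
  simpa only using h

theorem summable_tsum_mul_norm (A A' : WienerAlg B) :
    Summable fun k => ∑' l, ‖A l‖ * ‖A' (k - l)‖ := by
  have h := (summable_mul_prod_symm A A').prod
  simpa only using h

theorem summable_mul_fiber (A A' : WienerAlg B) (k : Zd d) :
    Summable fun l => A l * Seq.shiftHom l (A' (k - l)) := by
  refine .of_norm_bounded (g := fun l => ‖A l‖ * ‖A' (k - l)‖) ?_ fun l => ?_
  · exact summable_mul_norm_fiber A A' k
  · exact (norm_mul_le _ _).trans_eq (by simp)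

theorem norm_mulDiag_le (A A' : WienerAlg B) (k : Zd d) :
    ‖∑' l, A l * Seq.shiftHom l (A' (k - l))‖ ≤ ∑' l, ‖A l‖ * ‖A' (k - l)‖ := by
  refine tsum_of_norm_bounded (summable_mul_norm_fiber A A' k).hasSum fun l => ?_
  exact (norm_mul_le _ _).trans_eq (by simp)

theorem summable_norm_mulDiag (A A' : WienerAlg B) :
    Summable fun k => ‖∑' l, A l * Seq.shiftHom l (A' (k - l))‖ :=
  .of_nonneg_of_le (fun _ => norm_nonneg _) (norm_mulDiag_le A A') (summable_tsum_mul_norm A A')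

/-- In terms of diagonals, matrix multiplication is a convolution twisted by translations; since
these are isometric, the estimates are those of `ℓ¹` convolution. -/
noncomputable instance : Mul (WienerAlg B) where
  mul A A' := ofDiags (fun k => ∑' l, A l * Seq.shiftHom l (A' (k - l)))
    (summable_norm_mulDiag A A')

theorem mul_apply (A A' : WienerAlg B) (k : Zd d) :
    (A * A') k = ∑' l, A l * Seq.shiftHom l (A' (k - l)) := rfl

theorem norm_mul_apply_le (A A' : WienerAlg B) (k : Zd d) :
    ‖(A * A') k‖ ≤ ∑' l, ‖A l‖ * ‖A' (k - l)‖ := norm_mulDiag_le A A' k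

theorem norm_mul_le' (A A' : WienerAlg B) : ‖A * A'‖ ≤ ‖A‖ * ‖A'‖ := by
  have hs := summable_mul_prod A A'
  have h1 : ∑' k, ‖(A * A') k‖ ≤ ∑' k, ∑' l, ‖A l‖ * ‖A' (k - l)‖ :=
    Summable.tsum_le_tsum (norm_mul_apply_le A A') (summable_norm (A * A')) (summable_tsum_mul_norm A A')
  have h2 : ∑' k, ∑' l, ‖A l‖ * ‖A' (k - l)‖ = ∑' l, ∑' k, ‖A l‖ * ‖A' (k - l)‖ :=
    Summable.tsum_comm (f := fun l k => ‖A l‖ * ‖A' (k - l)‖) hs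
  have h3 (l : Zd d) : ∑' k, ‖A l‖ * ‖A' (k - l)‖ = ‖A l‖ * ‖A'‖ := by
    rw [tsum_mul_left, ← (hasSum_norm A').tsum_eq]
    congr 1
    exact (Equiv.subRight l).tsum_eq fun k => ‖A' k‖
  rw [h2, tsum_congr h3, tsum_mul_right, (hasSum_norm A).tsum_eq, (hasSum_norm (A * A')).tsum_eq]
    at h1
  exact h1

/-- Apply the continuous evaluation at `i` to the series of diagonals and reindex by `l = i - k`.
Algebraic identities can thereafter be checked entry by entry. -/
theorem hasSum_mat_mul (A A' : WienerAlg B) (i j : Zd d) :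
    HasSum (fun k => mat A i k * mat A' k j) (mat (A * A') i j) := by
  have h := (summable_mul_fiber A A' (i - j)).hasSum.map (Seq.evalHom (B := B) i)
    (Seq.continuous_apply i)
  rw [← (Equiv.subLeft i).hasSum_iff] at h
  convert h using 1
  · funext k
    simp [mat_apply]
  · rfl

theorem isMatProd_mul (A A' : WienerAlg B) : IsMatProd (mat A) (mat A') (mat (A * A')) :=
  hasSum_mat_mul A A'

theorem mul_eq_of_isMatProd {A A' A'' : WienerAlg B} (h : IsMatProd (mat A) (mat A') (mat A'')) :
    A * A' = A'' :=
  mat_injective <| by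
    ext i j
    exact (hasSum_mat_mul A A' i j).unique (h i j)

theorem summable_mul₃ (A A' A'' : WienerAlg B) (i j : Zd d) :
    Summable fun x : Zd d × Zd d => mat A i x.1 * mat A' x.1 x.2 * mat A'' x.2 j := by
  refine .of_norm_bounded (g := fun x => ‖A'‖ * (‖mat A i x.1‖ * ‖mat A'' x.2 j‖)) ?_ fun x => ?_
  · exact ((A.summable_norm_row i).mul_of_nonneg (A''.summable_norm_col j)
      (fun _ => norm_nonneg _) (fun _ => norm_nonneg _)).mul_left _
  · rw [norm_mul, norm_mul]
    nlinarith [mul_le_mul_of_nonneg_right (norm_mat_le_norm A' x.1 x.2)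
      (mul_nonneg (norm_nonneg (mat A i x.1)) (norm_nonneg (mat A'' x.2 j)))]

theorem hasSum_mul₃_right (A A' A'' : WienerAlg B) :
    IsMatProd₃ (mat A) (mat A') (mat A'') (mat (A * (A' * A''))) := fun i j => by
  have h := (summable_mul₃ A A' A'' i j).hasSum
  have h1 := h.prod_fiberwise fun k => by
    simpa [mul_assoc] using ((hasSum_mat_mul A' A'' k j).mul_left (mat A i k))
  rwa [h1.unique (hasSum_mat_mul A (A' * A'') i j)] at h

theorem hasSum_mul₃_left (A A' A'' : WienerAlg B) :
    IsMatProd₃ (mat A) (mat A') (mat A'') (mat (A * A' * A'')) := fun i j => by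
  have h := (summable_mul₃ A A' A'' i j).hasSum
  have h1 := ((Equiv.prodComm _ _).hasSum_iff.2 h).prod_fiberwise fun k =>
    (hasSum_mat_mul A A' i k).mul_right (mat A'' k j)
  rwa [h1.unique (hasSum_mat_mul (A * A') A'' i j)] at h

/-- The diagonal matrix with given diagonal. -/
noncomputable def diag (a : B.Seq) : WienerAlg B :=
  (lp.single 1 0 a : lp (fun _ : Zd d => B.Seq) 1)

theorem diag_apply (a : B.Seq) (k : Zd d) : diag a k = if k = 0 then a else 0 := by
  show lp.single (E := fun _ : Zd d => B.Seq) 1 0 a k = _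
  rw [lp.single_apply]
  simp [Pi.single_apply]

@[simp] theorem diag_apply_zero (a : B.Seq) : diag a 0 = a := by simp [diag_apply]

theorem mat_diag (a : B.Seq) : mat (diag a) = Matrix.diagonal a := by
  ext i j
  by_cases h : i = j
  · simp [mat_apply, diag_apply, h]
  · simp [mat_apply, diag_apply, h, sub_eq_zero]

noncomputable instance : One (WienerAlg B) := ⟨diag 1⟩

theorem one_def : (1 : WienerAlg B) = diag 1 := rfl

@[simp] theorem mat_one : mat (1 : WienerAlg B) = 1 := by
  rw [one_def, mat_diag]
  exact Matrix.diagonal_one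

noncomputable instance : Ring (WienerAlg B) :=
  { (inferInstance : AddCommGroup (WienerAlg B)) with
    mul := (· * ·)
    one := 1
    left_distrib := fun A A' A'' => mul_eq_of_isMatProd fun i j => by
      simpa [mul_add] using (hasSum_mat_mul A A' i j).add (hasSum_mat_mul A A'' i j)
    right_distrib := fun A A' A'' => mul_eq_of_isMatProd fun i j => by
      simpa [add_mul] using (hasSum_mat_mul A A'' i j).add (hasSum_mat_mul A' A'' i j)
    zero_mul := fun A => mul_eq_of_isMatProd fun i j => by simp
    mul_zero := fun A => mul_eq_of_isMatProd fun i j => by simp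
    -- Both bracketings are iterated sums of one absolutely convergent double series.
    mul_assoc := fun A A' A'' => mat_injective <| by
      ext i j
      exact (hasSum_mul₃_left A A' A'' i j).unique (hasSum_mul₃_right A A' A'' i j)
    one_mul := fun A => mul_eq_of_isMatProd fun i j => by
      convert hasSum_single i fun k hk => ?_ using 1
      · simp
      · simp [Matrix.one_apply_ne' hk]
    mul_one := fun A => mul_eq_of_isMatProd fun i j => by
      convert hasSum_single j fun k hk => ?_ using 1
      · simp
      · simp [Matrix.one_apply_ne hk] }

noncomputable instance : NormedRing (WienerAlg B) :=
  { (inferInstance : NormedAddCommGroup (WienerAlg B)), (inferInstance : Ring (WienerAlg B)) with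
    norm_mul_le := norm_mul_le' }

@[simp] theorem one_apply_zero : (1 : WienerAlg B) 0 = 1 := diag_apply_zero 1

/-! ### Weighted `ℓ²` bounds and algebra weights -/

/-- `x` bounds the `ℓ²` norm of the diagonals of `A` with the weight `w`. -/
def WBound (w : Zd d → ℝ) (A : WienerAlg B) (x : ℝ) : Prop :=
  0 ≤ x ∧ ∀ s : Finset (Zd d), ∑ k ∈ s, (‖A k‖ * w k) ^ 2 ≤ x ^ 2

namespace WBound

variable {w w' : Zd d → ℝ} {A A' : WienerAlg B} {x y : ℝ}

theorem mono (h : WBound w A x) (hxy : x ≤ y) : WBound w A y :=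
  ⟨h.1.trans hxy, fun s => (h.2 s).trans (pow_le_pow_left₀ h.1 hxy 2)⟩

theorem of_le (hw : ∀ k, 0 ≤ w k) (h : WBound w' A' x) {c : ℝ} (hc : 0 ≤ c)
    (hle : ∀ k, ‖A k‖ * w k ≤ c * (‖A' k‖ * w' k)) : WBound w A (c * x) := by
  refine ⟨mul_nonneg hc h.1, fun s => ?_⟩
  calc ∑ k ∈ s, (‖A k‖ * w k) ^ 2 ≤ ∑ k ∈ s, (c * (‖A' k‖ * w' k)) ^ 2 :=
        Finset.sum_le_sum fun k _ =>
          pow_le_pow_left₀ (mul_nonneg (norm_nonneg _) (hw k)) (hle k) 2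
    _ = c ^ 2 * ∑ k ∈ s, (‖A' k‖ * w' k) ^ 2 := by simp_rw [mul_pow, Finset.mul_sum]
    _ ≤ c ^ 2 * x ^ 2 := mul_le_mul_of_nonneg_left (h.2 s) (sq_nonneg c)
    _ = (c * x) ^ 2 := (mul_pow _ _ _).symm

theorem of_le' (hw : ∀ k, 0 ≤ w k) (h : WBound w' A' x)
    (hle : ∀ k, ‖A k‖ * w k ≤ ‖A' k‖ * w' k) : WBound w A x := by
  simpa using of_le hw h zero_le_one (by simpa using hle)

theorem weight_mono (hw : ∀ k, 0 ≤ w k) (h : WBound w' A x) (hle : ∀ k, w k ≤ w' k) :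
    WBound w A x :=
  of_le' hw h fun k => mul_le_mul_of_nonneg_left (hle k) (norm_nonneg _)

theorem zero (w : Zd d → ℝ) : WBound w (0 : WienerAlg B) 0 := ⟨le_rfl, fun s => by simp⟩

theorem neg (h : WBound w A x) : WBound w (-A) x := ⟨h.1, fun s => by simpa using h.2 s⟩

theorem add (hw : ∀ k, 0 ≤ w k) (h : WBound w A x) (h' : WBound w A' y) :
    WBound w (A + A') (x + y) := by
  refine ⟨add_nonneg h.1 h'.1, fun s => ?_⟩
  have h1 : (∑ k ∈ s, (‖A k‖ * w k) * (‖A' k‖ * w k)) ≤ x * y := by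
    refine le_of_sq_le_sq ?_ (mul_nonneg h.1 h'.1)
    rw [mul_pow]
    exact (Finset.sum_mul_sq_le_sq_mul_sq s _ _).trans
      (mul_le_mul (h.2 s) (h'.2 s) (Finset.sum_nonneg fun _ _ => sq_nonneg _) (sq_nonneg _))
  calc ∑ k ∈ s, (‖(A + A') k‖ * w k) ^ 2 ≤ ∑ k ∈ s, (‖A k‖ * w k + ‖A' k‖ * w k) ^ 2 := by
        refine Finset.sum_le_sum fun k _ =>
          pow_le_pow_left₀ (mul_nonneg (norm_nonneg _) (hw k)) ?_ 2
        rw [← add_mul]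
        exact mul_le_mul_of_nonneg_right (norm_add_le _ _) (hw k)
    _ = ∑ k ∈ s, (‖A k‖ * w k) ^ 2 + 2 * ∑ k ∈ s, (‖A k‖ * w k) * (‖A' k‖ * w k)
          + ∑ k ∈ s, (‖A' k‖ * w k) ^ 2 := by
        rw [Finset.mul_sum, ← Finset.sum_add_distrib, ← Finset.sum_add_distrib]
        exact Finset.sum_congr rfl fun k _ => by ring
    _ ≤ (x + y) ^ 2 := by nlinarith [h.2 s, h'.2 s]

theorem sub (hw : ∀ k, 0 ≤ w k) (h : WBound w A x) (h' : WBound w A' y) :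
    WBound w (A - A') (x + y) := by
  rw [sub_eq_add_neg]
  exact h.add hw h'.neg

/-- Only finite partial sums are bounded, and each depends continuously on finitely many diagonals.
Hence weighted bounds survive limits taken merely in the `ℓ¹` norm, and no completeness of the
weighted spaces is needed. -/
theorem of_tendsto {ι : Type*} {l : Filter ι} [l.NeBot] {u : ι → WienerAlg B} {f : ι → ℝ}
    (hu : Tendsto u l (𝓝 A)) (hf : Tendsto f l (𝓝 x)) (h : ∀ n, WBound w (u n) (f n)) :
    WBound w A x := by
  refine ⟨ge_of_tendsto' hf fun n => (h n).1, fun s => ?_⟩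
  refine le_of_tendsto_of_tendsto' (tendsto_finsetSum s fun k _ => ?_) (hf.pow 2) fun n => (h n).2 s
  exact ((((continuous_apply k).tendsto A).comp hu).norm.mul_const _).pow 2

theorem sum (hw : ∀ k, 0 ≤ w k) {ι : Type*} (t : Finset ι) {u : ι → WienerAlg B} {f : ι → ℝ}
    (h : ∀ n ∈ t, WBound w (u n) (f n)) : WBound w (∑ n ∈ t, u n) (∑ n ∈ t, f n) := by
  classical
  induction t using Finset.induction_on with
  | empty => simpa using zero w
  | insert a t ha ih =>
    rw [Finset.sum_insert ha, Finset.sum_insert ha]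
    exact (h a (Finset.mem_insert_self a t)).add hw
      (ih fun n hn => h n (Finset.mem_insert_of_mem hn))

theorem hasSum (hw : ∀ k, 0 ≤ w k) {ι : Type*} {u : ι → WienerAlg B} {f : ι → ℝ}
    (hu : HasSum u A) (hf : HasSum f x) (h : ∀ n, WBound w (u n) (f n)) : WBound w A x :=
  of_tendsto hu hf fun t => sum hw t fun n _ => h n

theorem diag (hw : ∀ k, 0 ≤ w k) (a : B.Seq) : WBound w (diag a) (‖a‖ * w 0) := by
  refine ⟨mul_nonneg (norm_nonneg _) (hw 0), fun s => ?_⟩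
  have h0 : ∀ k, k ≠ 0 → (‖WienerAlg.diag a k‖ * w k) ^ 2 = 0 := fun k hk => by
    simp [diag_apply, hk]
  by_cases hs : (0 : Zd d) ∈ s
  · rw [Finset.sum_eq_single_of_mem 0 hs fun k _ hk => h0 k hk, diag_apply_zero]
  · rw [Finset.sum_eq_zero fun k hk => h0 k (by rintro rfl; exact hs hk)]
    positivity

end WBound

/-- A weight for which the weighted `ℓ²` norm is submultiplicative and dominates the
`ℓ¹` norm. -/
structure IsAlgWeight (w : Zd d → ℝ) : Prop where
  pos : ∀ k, 0 < w k
  sum_inv_sq_le : ∀ s : Finset (Zd d), ∑ k ∈ s, ((w k)⁻¹) ^ 2 ≤ 1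
  sum_div_sq_le : ∀ (k : Zd d) (s : Finset (Zd d)), ∑ l ∈ s, (w k / (w l * w (k - l))) ^ 2 ≤ 1

namespace IsAlgWeight

variable {w : Zd d → ℝ} {A A' : WienerAlg B} {x y : ℝ}

theorem nonneg (hw : IsAlgWeight w) (k : Zd d) : 0 ≤ w k := (hw.pos k).le

/-- Cauchy–Schwarz against the sequence `w⁻¹`, whose `ℓ²` norm is at most `1`. -/
theorem norm_le (hw : IsAlgWeight w) (h : WBound w A x) : ‖A‖ ≤ x := by
  refine norm_le_of_sum_le A fun s => le_of_sq_le_sq ?_ h.1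
  calc (∑ k ∈ s, ‖A k‖) ^ 2 = (∑ k ∈ s, (w k)⁻¹ * (‖A k‖ * w k)) ^ 2 := by
        congr 1
        refine Finset.sum_congr rfl fun k _ => ?_
        have := (hw.pos k).ne'
        field_simp
    _ ≤ (∑ k ∈ s, ((w k)⁻¹) ^ 2) * ∑ k ∈ s, (‖A k‖ * w k) ^ 2 :=
        Finset.sum_mul_sq_le_sq_mul_sq s _ _
    _ ≤ 1 * x ^ 2 := mul_le_mul (hw.sum_inv_sq_le s) (h.2 s)
        (Finset.sum_nonneg fun _ _ => sq_nonneg _) zero_le_one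
    _ = x ^ 2 := one_mul _

/-- Cauchy–Schwarz in the convolution, with factor `w k / (w l * w (k - l))`, bounds the square of
each weighted diagonal by a convolution of squares, which is then summed over `k`. -/
theorem mul (hw : IsAlgWeight w) (h : WBound w A x) (h' : WBound w A' y) :
    WBound w (A * A') (x * y) := by
  refine ⟨mul_nonneg h.1 h'.1, fun s => ?_⟩
  set a : Zd d → ℝ := fun k => ‖A k‖ * w k with ha
  set b : Zd d → ℝ := fun k => ‖A' k‖ * w k with hb
  have ha2 : Summable fun l => a l ^ 2 :=
    summable_of_sum_le (fun _ => sq_nonneg _) h.2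
  have hf (k : Zd d) : Summable fun l => (a l * b (k - l)) ^ 2 := by
    refine .of_nonneg_of_le (fun _ => sq_nonneg _) (fun l => ?_) (ha2.mul_right (y ^ 2))
    rw [mul_pow]
    refine mul_le_mul_of_nonneg_left ?_ (sq_nonneg _)
    simpa using h'.2 {k - l}
  have key (k : Zd d) : (‖(A * A') k‖ * w k) ^ 2 ≤ ∑' l, (a l * b (k - l)) ^ 2 := by
    have h0 : 0 ≤ ∑' l, (a l * b (k - l)) ^ 2 := tsum_nonneg fun _ => sq_nonneg _
    rw [← Real.sq_sqrt h0]
    refine pow_le_pow_left₀ (mul_nonneg (norm_nonneg _) (hw.nonneg k)) ?_ 2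
    refine (mul_le_mul_of_nonneg_right (norm_mul_apply_le A A' k) (hw.nonneg k)).trans ?_
    rw [← tsum_mul_right]
    refine Real.tsum_le_of_sum_le (fun l => by have := hw.nonneg k; positivity) fun t => ?_
    refine Real.le_sqrt_of_sq_le ?_
    calc (∑ l ∈ t, ‖A l‖ * ‖A' (k - l)‖ * w k) ^ 2
        = (∑ l ∈ t, (w k / (w l * w (k - l))) * (a l * b (k - l))) ^ 2 := by
          congr 1
          refine Finset.sum_congr rfl fun l _ => ?_
          have h1 := (hw.pos l).ne'
          have h2 := (hw.pos (k - l)).ne'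
          simp only [ha, hb]
          field_simp
      _ ≤ (∑ l ∈ t, (w k / (w l * w (k - l))) ^ 2) * ∑ l ∈ t, (a l * b (k - l)) ^ 2 :=
          Finset.sum_mul_sq_le_sq_mul_sq t _ _
      _ ≤ 1 * ∑' l, (a l * b (k - l)) ^ 2 :=
          mul_le_mul (hw.sum_div_sq_le k t) ((hf k).sum_le_tsum t fun _ _ => sq_nonneg _)
            (Finset.sum_nonneg fun _ _ => sq_nonneg _) zero_le_one
      _ = _ := one_mul _
  calc ∑ k ∈ s, (‖(A * A') k‖ * w k) ^ 2 ≤ ∑ k ∈ s, ∑' l, (a l * b (k - l)) ^ 2 :=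
        Finset.sum_le_sum fun k _ => key k
    _ = ∑' l, ∑ k ∈ s, (a l * b (k - l)) ^ 2 := (Summable.tsum_finsetSum fun k _ => hf k).symm
    _ ≤ ∑' l, a l ^ 2 * y ^ 2 := by
        refine Summable.tsum_le_tsum (fun l => ?_) (summable_sum fun k _ => hf k)
          (ha2.mul_right _)
        simp_rw [mul_pow, ← Finset.mul_sum]
        refine mul_le_mul_of_nonneg_left ?_ (sq_nonneg _)
        have := h'.2 (s.map (Equiv.subRight l).toEmbedding)
        simpa [Finset.sum_map] using this
    _ = (∑' l, a l ^ 2) * y ^ 2 := tsum_mul_right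
    _ ≤ x ^ 2 * y ^ 2 :=
        mul_le_mul_of_nonneg_right (Real.tsum_le_of_sum_le (fun _ => sq_nonneg _) h.2)
          (sq_nonneg _)
    _ = (x * y) ^ 2 := (mul_pow _ _ _).symm

theorem pow_succ (hw : IsAlgWeight w) (h : WBound w A x) (n : ℕ) :
    WBound w (A ^ (n + 1)) (x ^ (n + 1)) := by
  induction n with
  | zero => simpa using h
  | succ n ih =>
    rw [_root_.pow_succ, _root_.pow_succ x]
    exact hw.mul ih h

end IsAlgWeight

/-- The inverse of `1 + V`, by the Neumann series. -/
noncomputable def invOneAdd (V : WienerAlg B) : WienerAlg B := ∑' n : ℕ, (-V) ^ n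

section

variable {V : WienerAlg B}

theorem hasSum_invOneAdd (hV : ‖V‖ < 1) : HasSum (fun n : ℕ => (-V) ^ n) (invOneAdd V) :=
  (summable_geometric_of_norm_lt_one (x := -V) (by rwa [norm_neg])).hasSum

theorem one_add_mul_invOneAdd (hV : ‖V‖ < 1) : (1 + V) * invOneAdd V = 1 := by
  have := mul_neg_geom_series (-V) (by rwa [norm_neg])
  rwa [sub_neg_eq_add] at this

theorem invOneAdd_mul_one_add (hV : ‖V‖ < 1) : invOneAdd V * (1 + V) = 1 := by
  have := geom_series_mul_neg (-V) (by rwa [norm_neg])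
  rwa [sub_neg_eq_add] at this

theorem IsAlgWeight.invOneAdd_sub_one {w : Zd d → ℝ} (hw : IsAlgWeight w) {x : ℝ}
    (h : WBound w V x) (hx : x ≤ 1 / 2) : WBound w (invOneAdd V - 1) (2 * x) := by
  have hV : ‖V‖ < 1 := ((hw.norm_le h).trans hx).trans_lt (by norm_num)
  have h1 : HasSum (fun n : ℕ => (-V) ^ (n + 1)) (invOneAdd V - 1) := by
    simpa using (hasSum_nat_add_iff' 1).2 (hasSum_invOneAdd hV)
  have h2 : HasSum (fun n : ℕ => x ^ (n + 1)) (x * (1 - x)⁻¹) := by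
    simpa [_root_.pow_succ'] using
      (hasSum_geometric_of_lt_one h.1 (hx.trans_lt (by norm_num))).mul_left x
  refine (WBound.hasSum hw.nonneg h1 h2 fun n => hw.pow_succ h.neg n).mono ?_
  rw [mul_comm]
  refine mul_le_mul_of_nonneg_right ?_ h.1
  rw [inv_le_comm₀ (by linarith) two_pos]
  linarith

end

end WienerAlg

/-! ### The weight `⟨k⟩` and its summability -/

section Bracket

variable {d : ℕ}

theorem one_le_bracket (k : Zd d) : 1 ≤ bracket k := le_max_left _ _

theorem bracket_pos (k : Zd d) : 0 < bracket k := zero_lt_one.trans_le (one_le_bracket k)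

@[simp] theorem bracket_zero : bracket (0 : Zd d) = 1 := by simp [bracket]

@[simp] theorem bracket_neg (k : Zd d) : bracket (-k) = bracket k := by simp [bracket]

theorem norm_le_bracket (k : Zd d) : ‖k‖ ≤ bracket k := le_max_right _ _

theorem bracket_add_le (k l : Zd d) : bracket (k + l) ≤ bracket k + bracket l :=
  max_le (by linarith [one_le_bracket k, one_le_bracket l])
    ((norm_add_le k l).trans (add_le_add (norm_le_bracket k) (norm_le_bracket l)))

/-- The constant is uniform in `t ∈ [0, β]`, so that one normalising constant serves all the weights
of the iteration. -/
theorem bracket_rpow_add_le {t β : ℝ} (ht : 0 ≤ t) (htβ : t ≤ β) (k l : Zd d) :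
    bracket (k + l) ^ t ≤ 2 ^ β * (bracket k ^ t + bracket l ^ t) := by
  have h2 : (2 : ℝ) ^ t ≤ 2 ^ β := Real.rpow_le_rpow_of_exponent_le one_le_two htβ
  have hk := Real.rpow_nonneg (bracket_pos k).le t
  have hl := Real.rpow_nonneg (bracket_pos l).le t
  refine le_trans ?_ (mul_le_mul_of_nonneg_right h2 (add_nonneg hk hl))
  rcases le_total (bracket k) (bracket l) with h | h
  · calc bracket (k + l) ^ t ≤ (2 * bracket l) ^ t :=
          Real.rpow_le_rpow (bracket_pos _).le (by linarith [bracket_add_le k l]) ht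
      _ = 2 ^ t * bracket l ^ t := Real.mul_rpow two_pos.le (bracket_pos l).le
      _ ≤ _ := by nlinarith [Real.rpow_nonneg (two_pos (α := ℝ)).le t]
  · calc bracket (k + l) ^ t ≤ (2 * bracket k) ^ t :=
          Real.rpow_le_rpow (bracket_pos _).le (by linarith [bracket_add_le k l]) ht
      _ = 2 ^ t * bracket k ^ t := Real.mul_rpow two_pos.le (bracket_pos k).le
      _ ≤ _ := by nlinarith [Real.rpow_nonneg (two_pos (α := ℝ)).le t]

/-- Embed `ℤ^d` in `ℝ^d` as the standard lattice of rank `d`, preserving the sup norm. -/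
theorem summable_norm_rpow_neg {r : ℝ} (hr : (d : ℝ) < r) :
    Summable fun k : Zd d => ‖k‖ ^ (-r) := by
  let b := Pi.basisFun ℝ (Fin d)
  let L : Submodule ℤ (Fin d → ℝ) := Submodule.span ℤ (Set.range b)
  have hmem (k : Zd d) : (fun i => (k i : ℝ)) ∈ L := by
    have : (fun i => (k i : ℝ)) = ∑ i, k i • b i := by
      ext j
      simp [b, Finset.sum_apply, Pi.single_apply]
    rw [this]
    exact Submodule.sum_mem _ fun i _ =>
      Submodule.smul_mem _ _ (Submodule.subset_span (Set.mem_range_self i))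
  let f : Zd d → L := fun k => ⟨_, hmem k⟩
  have hf : Function.Injective f := fun k l h => by
    ext i
    have : (k i : ℝ) = l i := congrFun (Subtype.ext_iff.1 h) i
    exact_mod_cast this
  have hrank : Module.finrank ℤ L = d := by
    rw [Module.finrank_eq_card_basis (b.restrictScalars ℤ)]
    simp
  have h := (ZLattice.summable_norm_rpow (L := L) (-r) (by rw [hrank]; linarith)).comp_injective hf
  refine h.congr fun k => ?_
  have : ‖(f k : Fin d → ℝ)‖ = ‖k‖ := by
    change ‖(fun i => (k i : ℝ))‖ = ‖k‖
    simp only [Pi.norm_def, NNReal.coe_inj]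
    refine Finset.sup_congr rfl fun i _ => ?_
    exact NNReal.eq (by simp [Int.norm_eq_abs])
  simp [this]

theorem summable_bracket_rpow_neg {r : ℝ} (hr : (d : ℝ) < r) :
    Summable fun k : Zd d => bracket k ^ (-r) := by
  refine (summable_norm_rpow_neg hr).congr_cofinite ?_
  have h : ∀ᶠ k : Zd d in cofinite, k ≠ 0 := by
    simp
  filter_upwards [h] with k hk
  have h1 : 1 ≤ ‖k‖ := by
    obtain ⟨i, hi⟩ := Function.ne_iff.1 hk
    refine le_trans ?_ (norm_le_pi_norm k i)
    rw [Int.norm_eq_abs]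
    exact_mod_cast Int.one_le_abs hi
  rw [bracket, max_eq_right h1]

end Bracket

namespace WienerAlg

variable {d : ℕ} {B : TIBanachAlgebra d}

/-- Quasi-subadditivity gives `v k / (v l * v (k - l)) ≤ 2 ^ β * (1 / v l + 1 / v (k - l))`, and the
squares of `1 / v` are summable because `2α₀ > d`. The constant `c` does not depend on `v`, which is
what permits a new weight at every step of the iteration. -/
theorem exists_isAlgWeight (d : ℕ) {α₀ : ℝ} (hα₀ : (d : ℝ) / 2 < α₀) (β : ℝ) (hβ : 0 ≤ β) :
    ∃ c : ℝ, 1 ≤ c ∧ ∀ v : Zd d → ℝ, (∀ k, bracket k ^ α₀ ≤ v k) →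
      (∀ k l, v (k + l) ≤ 2 ^ β * (v k + v l)) → IsAlgWeight fun k => c * v k := by
  have hS : Summable fun k : Zd d => bracket k ^ (-(2 * α₀)) :=
    summable_bracket_rpow_neg (by linarith)
  set S : ℝ := ∑' k : Zd d, bracket k ^ (-(2 * α₀)) with hSdef
  have hS0 : 0 ≤ S := tsum_nonneg fun k => Real.rpow_nonneg (bracket_pos k).le _
  set κ : ℝ := 2 ^ β with hκ
  have hκ1 : 1 ≤ κ := Real.one_le_rpow one_le_two hβ
  -- The summand `1` gives `c ≥ 1`, so `c ^ 2 ≥ c ≥ 4 * κ ^ 2 * S` without a square root.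
  set c : ℝ := 1 + 4 * κ ^ 2 * S with hc
  have hc1 : 1 ≤ c := by have : 0 ≤ 4 * κ ^ 2 * S := by positivity
                         linarith
  have hc0 : 0 < c := by linarith
  have hcS : 4 * κ ^ 2 * S ≤ c ^ 2 := by nlinarith
  refine ⟨c, hc1, fun v hv hadd => ?_⟩
  have hvpos (k : Zd d) : 0 < v k := (Real.rpow_pos_of_pos (bracket_pos k) _).trans_le (hv k)
  have hinv (k : Zd d) : ((v k)⁻¹) ^ 2 ≤ bracket k ^ (-(2 * α₀)) := by
    have h1 : (v k)⁻¹ ≤ (bracket k ^ α₀)⁻¹ :=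
      inv_anti₀ (Real.rpow_pos_of_pos (bracket_pos k) _) (hv k)
    refine (pow_le_pow_left₀ (inv_nonneg.2 (hvpos k).le) h1 2).trans_eq ?_
    rw [← Real.rpow_neg (bracket_pos k).le, ← Real.rpow_natCast, ← Real.rpow_mul (bracket_pos k).le]
    congr 1
    push_cast
    ring
  have hsum (s : Finset (Zd d)) : ∑ k ∈ s, ((v k)⁻¹) ^ 2 ≤ S :=
    (Finset.sum_le_sum fun k _ => hinv k).trans
      (hS.sum_le_tsum s fun k _ => Real.rpow_nonneg (bracket_pos k).le _)
  have hsum' (k : Zd d) (s : Finset (Zd d)) : ∑ l ∈ s, ((v (k - l))⁻¹) ^ 2 ≤ S := by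
    have := hsum (s.map (Equiv.subLeft k).toEmbedding)
    simpa [Finset.sum_map] using this
  refine ⟨fun k => mul_pos hc0 (hvpos k), fun s => ?_, fun k s => ?_⟩
  · calc ∑ k ∈ s, ((c * v k)⁻¹) ^ 2 = (c ^ 2)⁻¹ * ∑ k ∈ s, ((v k)⁻¹) ^ 2 := by
          rw [Finset.mul_sum]
          exact Finset.sum_congr rfl fun k _ => by rw [mul_inv, mul_pow, inv_pow]
      _ ≤ (c ^ 2)⁻¹ * c ^ 2 :=
          mul_le_mul_of_nonneg_left ((hsum s).trans (by nlinarith [one_le_pow₀ hκ1 (n := 2)])) (by positivity)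
      _ = 1 := inv_mul_cancel₀ (by positivity)
  · have hterm (l : Zd d) : (c * v k / (c * v l * (c * v (k - l)))) ^ 2 ≤
        (c ^ 2)⁻¹ * (2 * κ ^ 2) * (((v l)⁻¹) ^ 2 + ((v (k - l))⁻¹) ^ 2) := by
      have h1 := hadd l (k - l)
      rw [add_sub_cancel] at h1
      have hl := hvpos l
      have hl' := hvpos (k - l)
      have h2 : v k / (v l * v (k - l)) ≤ κ * ((v l)⁻¹ + (v (k - l))⁻¹) := by
        rw [div_le_iff₀ (mul_pos hl hl')]
        refine h1.trans_eq ?_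
        field_simp
        ring
      have h3 : c * v k / (c * v l * (c * v (k - l))) = c⁻¹ * (v k / (v l * v (k - l))) := by
        field_simp
      rw [h3, mul_pow, inv_pow, mul_assoc]
      refine mul_le_mul_of_nonneg_left ?_ (by positivity)
      refine (pow_le_pow_left₀ (div_nonneg (hvpos k).le (mul_pos hl hl').le) h2 2).trans ?_
      rw [mul_pow, mul_assoc, mul_left_comm]
      exact mul_le_mul_of_nonneg_left (add_sq_le) (by positivity)
    calc ∑ l ∈ s, (c * v k / (c * v l * (c * v (k - l)))) ^ 2
        ≤ ∑ l ∈ s, (c ^ 2)⁻¹ * (2 * κ ^ 2) * (((v l)⁻¹) ^ 2 + ((v (k - l))⁻¹) ^ 2) :=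
          Finset.sum_le_sum fun l _ => hterm l
      _ = (c ^ 2)⁻¹ * (2 * κ ^ 2) *
            (∑ l ∈ s, ((v l)⁻¹) ^ 2 + ∑ l ∈ s, ((v (k - l))⁻¹) ^ 2) := by
          rw [← Finset.mul_sum, Finset.sum_add_distrib]
      _ ≤ (c ^ 2)⁻¹ * (2 * κ ^ 2) * (S + S) :=
          mul_le_mul_of_nonneg_left (add_le_add (hsum s) (hsum' k s)) (by positivity)
      _ = (c ^ 2)⁻¹ * (4 * κ ^ 2 * S) := by ring
      _ ≤ (c ^ 2)⁻¹ * c ^ 2 := mul_le_mul_of_nonneg_left hcS (by positivity)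
      _ = 1 := inv_mul_cancel₀ (by positivity)

/-! ### The Sobolev type spaces -/

theorem seqNorm_coe (a : B.Seq) : B.seqNorm a = ‖a‖ := by
  rw [TIBanachAlgebra.seqNorm, dif_pos (show (a : Zd d → ℂ) ∈ B.carrier from a.2)]
  rfl

theorem coe_mem_carrier (a : B.Seq) : (a : Zd d → ℂ) ∈ B.carrier := a.2

theorem kDiag_mat (A : WienerAlg B) (k : Zd d) : kDiag (mat A) k = A k := by
  ext i
  simp [kDiag, mat_apply]

theorem sq_mul_bracket_rpow (x s : ℝ) (k : Zd d) :
    x ^ 2 * bracket k ^ (2 * s) = (x * bracket k ^ s) ^ 2 := by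
  rw [mul_pow, ← Real.rpow_natCast (bracket k ^ s), ← Real.rpow_mul (bracket_pos k).le, mul_comm 2 s]
  norm_num

theorem mat_mem_MSpace {A : WienerAlg B} {s x : ℝ} (h : WBound (fun k => bracket k ^ s) A x) :
    mat A ∈ MSpace B s := by
  refine ⟨fun k => by rw [kDiag_mat]; exact coe_mem_carrier _, ?_⟩
  simp_rw [kDiag_mat, seqNorm_coe, sq_mul_bracket_rpow]
  exact summable_of_sum_le (fun _ => sq_nonneg _) h.2

theorem sobNorm_mat_le {A : WienerAlg B} {s x : ℝ} (h : WBound (fun k => bracket k ^ s) A x) :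
    sobNorm B s (mat A) ≤ x := by
  simp_rw [sobNorm, kDiag_mat, seqNorm_coe, sq_mul_bracket_rpow]
  rw [Real.sqrt_le_left h.1]
  exact Real.tsum_le_of_sum_le (fun _ => sq_nonneg _) h.2

/-- For `s > d/2` the weighted `ℓ²` condition implies `ℓ¹` summability, here from `xy ≤ x² + y²`
with `y = ⟨k⟩^(-s)`. -/
theorem exists_mat_eq {s : ℝ} (hs : (d : ℝ) / 2 < s) {A : InfMat d} (hA : A ∈ MSpace B s) :
    ∃ A' : WienerAlg B, mat A' = A ∧ WBound (fun k => bracket k ^ s) A' (sobNorm B s A) := by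
  let f : Zd d → B.Seq := fun k => (⟨kDiag A k, hA.1 k⟩ : B.carrier)
  have hf (k : Zd d) : B.seqNorm (kDiag A k) = ‖f k‖ := seqNorm_coe (f k)
  have hsum : Summable fun k => (‖f k‖ * bracket k ^ s) ^ 2 := by
    simpa only [hf, sq_mul_bracket_rpow] using hA.2
  have hS : Summable fun k : Zd d => (bracket k ^ (-s)) ^ 2 := by
    refine (summable_bracket_rpow_neg (d := d) (r := 2 * s) (by linarith)).congr fun k => ?_
    rw [← Real.rpow_natCast, ← Real.rpow_mul (bracket_pos k).le]
    congr 1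
    push_cast
    ring
  have hf1 : Summable fun k => ‖f k‖ := by
    refine .of_nonneg_of_le (fun _ => norm_nonneg _) (fun k => ?_) (hsum.add hS)
    have h1 : ‖f k‖ = ‖f k‖ * bracket k ^ s * bracket k ^ (-s) := by
      rw [mul_assoc, ← Real.rpow_add (bracket_pos k)]
      simp
    nlinarith [sq_nonneg (‖f k‖ * bracket k ^ s - bracket k ^ (-s)),
      sq_nonneg (‖f k‖ * bracket k ^ s), sq_nonneg (bracket k ^ (-s))]
  refine ⟨ofDiags f hf1, ?_, Real.sqrt_nonneg _, fun t => ?_⟩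
  · ext i j
    change A i (i - (i - j)) = A i j
    rw [sub_sub_cancel]
  · rw [sobNorm, Real.sq_sqrt (tsum_nonneg fun k => by
      rw [sq_mul_bracket_rpow]; exact sq_nonneg _)]
    simp_rw [hf, sq_mul_bracket_rpow]
    exact hsum.sum_le_tsum t fun _ _ => sq_nonneg _

theorem WBound.diag_bracket (a : B.Seq) (s : ℝ) :
    WBound (fun k => bracket k ^ s) (WienerAlg.diag a) ‖a‖ := by
  simpa using WBound.diag (w := fun k => bracket k ^ s)
    (fun k => Real.rpow_nonneg (bracket_pos k).le s) a

theorem mat_diag_mem_MDiag (a : B.Seq) : mat (diag a) ∈ MDiag B :=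
  ⟨fun s _ => mat_mem_MSpace (WBound.diag_bracket a s), by
    rw [mat_diag]; exact Matrix.isDiag_diagonal _⟩

theorem continuous_mat (i j : Zd d) : Continuous fun A : WienerAlg B => mat A i j :=
  (Seq.continuous_apply i).comp (continuous_apply (i - j))

/-! ### The commutator with an unbounded diagonal matrix -/

/-- `F` is the commutator of the diagonal matrix of `p` with `V`. -/
def IsComm (p : Zd d → ℂ) (V F : WienerAlg B) : Prop :=
  ∀ i j, (p i - p j) * mat V i j = mat F i j

namespace IsComm

variable {p : Zd d → ℂ} {V V' F F' : WienerAlg B}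

theorem one (p : Zd d → ℂ) : IsComm p (1 : WienerAlg B) 0 := fun i j => by
  by_cases h : i = j
  · simp [h]
  · simp [h]

theorem add (h : IsComm p V F) (h' : IsComm p V' F') : IsComm p (V + V') (F + F') := fun i j => by
  simp only [mat_add, Matrix.add_apply, mul_add]
  rw [h, h']

theorem mul (h : IsComm p V F) (h' : IsComm p V' F') :
    IsComm p (V * V') (F * V' + V * F') := fun i j => by
  have h1 := (hasSum_mat_mul V V' i j).mul_left (p i - p j)
  have h2 := (hasSum_mat_mul F V' i j).add (hasSum_mat_mul V F' i j)
  refine h1.unique ?_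
  have e : (fun k => (p i - p j) * (mat V i k * mat V' k j)) =
      fun k => mat F i k * mat V' k j + mat V i k * mat F' k j := by
    funext k
    rw [← h, ← h']
    ring
  rw [e]
  exact h2

/-- For fixed entries the factor `p i - p j` is a constant, so unboundedness of `p` plays no role.
-/
theorem of_tendsto {ι : Type*} {l : Filter ι} [l.NeBot] {v f : ι → WienerAlg B}
    (hv : Tendsto v l (𝓝 V)) (hf : Tendsto f l (𝓝 F)) (h : ∀ n, IsComm p (v n) (f n)) :
    IsComm p V F := fun i j =>
  tendsto_nhds_unique
    ((((continuous_mat i j).tendsto V).comp hv).const_mul (p i - p j))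
    ((((continuous_mat i j).tendsto F).comp hf).congr fun n => (h n i j).symm)

end IsComm

/-! ### Matrices with real entries -/

/-- All entries of the matrix are real. -/
def IsReal (A : WienerAlg B) : Prop := ∀ i j, (mat A i j).im = 0

namespace IsReal

variable {A A' : WienerAlg B}

theorem add (h : IsReal A) (h' : IsReal A') : IsReal (A + A') := fun i j => by
  simp [h i j, h' i j]

theorem neg (h : IsReal A) : IsReal (-A) := fun i j => by simp [h i j]

theorem sub (h : IsReal A) (h' : IsReal A') : IsReal (A - A') := fun i j => by
  simp [h i j, h' i j]

theorem one : IsReal (1 : WienerAlg B) := fun i j => by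
  by_cases h : i = j <;> simp [h]

theorem mul (h : IsReal A) (h' : IsReal A') : IsReal (A * A') := fun i j => by
  refine (Complex.hasSum_im (hasSum_mat_mul A A' i j)).unique ?_
  convert hasSum_zero using 1
  funext k
  simp [Complex.mul_im, h i k, h' k j]

theorem pow (h : IsReal A) (n : ℕ) : IsReal (A ^ n) := by
  induction n with
  | zero => simpa using one
  | succ n ih => rw [pow_succ]; exact ih.mul h

theorem of_tendsto {ι : Type*} {l : Filter ι} [l.NeBot] {v : ι → WienerAlg B}
    (hv : Tendsto v l (𝓝 A)) (h : ∀ n, IsReal (v n)) : IsReal A := fun i j =>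
  tendsto_nhds_unique
    (((Complex.continuous_im.comp (continuous_mat i j)).tendsto A).comp hv)
    (tendsto_const_nhds.congr fun n => (h n i j).symm)

theorem sum {ι : Type*} (t : Finset ι) {v : ι → WienerAlg B} (h : ∀ n, IsReal (v n)) :
    IsReal (∑ n ∈ t, v n) := by
  classical
  induction t using Finset.induction_on with
  | empty => exact fun i j => by simp
  | insert a t ha ih => rw [Finset.sum_insert ha]; exact (h a).add ih

theorem invOneAdd (hA : ‖A‖ < 1) (h : IsReal A) : IsReal (invOneAdd A) :=
  of_tendsto (hasSum_invOneAdd hA) fun t => sum t fun n => h.neg.pow n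

theorem apply (h : IsReal A) (k i : Zd d) : (A k i).im = 0 := by
  rw [apply_eq_mat]
  exact h _ _

theorem of_apply (h : ∀ k i, (A k i).im = 0) : IsReal A := fun i j => h (i - j) i

theorem diag {a : B.Seq} (h : ∀ i, (a i).im = 0) : IsReal (diag a) := fun i j => by
  by_cases hij : i = j <;> simp [mat_diag, hij, h j]

end IsReal

/-! ### Truncation and the homological equation -/

/-- The part of `F` on the diagonals `0 < |k| ≤ N`. -/
noncomputable def trunc (N : ℝ) (F : WienerAlg B) : WienerAlg B :=
  open Classical in
  ofDiags (fun k => if k ≠ 0 ∧ ‖k‖ ≤ N then F k else 0)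
    (.of_nonneg_of_le (fun _ => norm_nonneg _) (fun k => by split_ifs <;> simp) F.summable_norm)

open Classical in
theorem trunc_apply (N : ℝ) (F : WienerAlg B) (k : Zd d) :
    trunc N F k = if k ≠ 0 ∧ ‖k‖ ≤ N then F k else 0 := rfl

theorem IsReal.trunc {F : WienerAlg B} (h : IsReal F) (N : ℝ) : IsReal (trunc N F) :=
  .of_apply fun k i => by
    rw [trunc_apply]
    split_ifs
    · exact h.apply k i
    · simp

/-- The homological equation is solved diagonal by diagonal: the `k`-th diagonal is multiplied by
the inverse of `p - σ_k p`, whose norm is at most `γ⁻¹ N^τ` on `0 < |k| ≤ N`. -/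
theorem exists_isComm_trunc {τ γ : ℝ} (hτ : 0 ≤ τ) (hγ : 0 < γ) {p : Zd d → ℂ}
    (hp : IsDistal B τ γ p) {N : ℝ} (F : WienerAlg B) :
    ∃ V : WienerAlg B, IsComm p V (trunc N F) ∧
      (∀ k, ‖V k‖ ≤ γ⁻¹ * N ^ τ * ‖F k‖ ∨ V k = 0) ∧ (∀ k, N < ‖k‖ → V k = 0) ∧
      ((∀ i, (p i).im = 0) → IsReal F → IsReal V) := by
  classical
  -- The value at `k = 0` is immaterial, since the truncation removes the main diagonal.
  let dv : Zd d → B.Seq := fun k =>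
    if hk : k ≠ 0 then (⟨fun i => (p i - shift k p i)⁻¹, (hp k hk).2.1⟩ : B.carrier) else 0
  have hdv (k : Zd d) (hk : k ≠ 0) (i : Zd d) : dv k i = (p i - p (i - k))⁻¹ := by
    have h : dv k = (⟨fun i => (p i - shift k p i)⁻¹, (hp k hk).2.1⟩ : B.carrier) := dif_pos hk
    rw [h]
    rfl
  have hdvn (k : Zd d) (hk : k ≠ 0) : ‖dv k‖ ≤ γ⁻¹ * ‖k‖ ^ τ := by
    rw [← seqNorm_coe]
    have : (dv k : Zd d → ℂ) = fun i => (p i - shift k p i)⁻¹ := funext fun i => hdv k hk i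
    rw [this]
    exact (hp k hk).2.2
  let f : Zd d → B.Seq := fun k => dv k * trunc N F k
  have hf0 (k : Zd d) (hk : ¬ (k ≠ 0 ∧ ‖k‖ ≤ N)) : f k = 0 := by
    simp only [f]
    rw [trunc_apply, if_neg hk, mul_zero]
  have hf1 (k : Zd d) (hk : k ≠ 0 ∧ ‖k‖ ≤ N) : ‖f k‖ ≤ γ⁻¹ * N ^ τ * ‖F k‖ := by
    simp only [f]
    rw [trunc_apply, if_pos hk]
    refine (norm_mul_le _ _).trans (mul_le_mul_of_nonneg_right ?_ (norm_nonneg _))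
    exact (hdvn k hk.1).trans (mul_le_mul_of_nonneg_left
      (Real.rpow_le_rpow (norm_nonneg _) hk.2 hτ) (inv_nonneg.2 hγ.le))
  have hsum : Summable fun k => ‖f k‖ := by
    refine .of_nonneg_of_le (fun _ => norm_nonneg _) (fun k => ?_)
      (F.summable_norm.mul_left |γ⁻¹ * N ^ τ|)
    by_cases hk : k ≠ 0 ∧ ‖k‖ ≤ N
    · exact (hf1 k hk).trans (mul_le_mul_of_nonneg_right (le_abs_self _) (norm_nonneg _))
    · rw [hf0 k hk, norm_zero]
      positivity
  refine ⟨ofDiags f hsum, fun i j => ?_, fun k => ?_, fun k hk => ?_, fun hpr hF => ?_⟩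
  · rw [mat_apply, mat_apply, ofDiags_apply]
    by_cases hk : i - j = 0
    · rw [trunc_apply, if_neg (by simp [hk]), sub_eq_zero.1 hk]
      simp
    · have hne := (hp _ hk).1 i
      simp only [shift, sub_sub_cancel] at hne
      simp only [f, Seq.mul_apply, hdv _ hk, sub_sub_cancel]
      rw [mul_inv_cancel_left₀ hne]
  · by_cases hk : k ≠ 0 ∧ ‖k‖ ≤ N
    · exact .inl (hf1 k hk)
    · exact .inr (hf0 k hk)
  · exact hf0 k fun h => (h.2.trans_lt hk).false
  · refine .of_apply fun k i => ?_
    rw [ofDiags_apply]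
    by_cases hk : k ≠ 0 ∧ ‖k‖ ≤ N
    · have h1 : (p i - p (i - k)).im = 0 := by simp [hpr]
      simp only [f, Seq.mul_apply, hdv _ hk.1, Complex.mul_im, Complex.inv_im, h1,
        (hF.trunc N).apply k i]
      simp
    · rw [hf0 k hk]
      simp

theorem diag_add (a b : B.Seq) : diag (a + b) = diag a + diag b :=
  ext fun k => by
    by_cases hk : k = 0 <;> simp [diag_apply, hk]

theorem diag_neg (a : B.Seq) : diag (-a) = -diag a :=
  ext fun k => by
    by_cases hk : k = 0 <;> simp [diag_apply, hk]

theorem diag_sub (a b : B.Seq) : diag (a - b) = diag a - diag b := by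
  rw [sub_eq_add_neg, diag_add, diag_neg, sub_eq_add_neg]

theorem diag_mul (a b : B.Seq) : diag (a * b) = diag a * diag b :=
  (mul_eq_of_isMatProd fun i j => by
    rw [mat_diag, mat_diag, mat_diag]
    convert hasSum_single i fun k hk => ?_ using 1
    · by_cases h : i = j <;> simp [h]
    · simp [Matrix.diagonal_apply_ne _ hk.symm]).symm

theorem trunc_neg (N : ℝ) (F : WienerAlg B) : trunc N (-F) = -trunc N F :=
  ext fun k => by
    simp only [trunc_apply, neg_apply]
    split_ifs <;> simp

theorem WBound.diagPart {w : Zd d → ℝ} (hw : ∀ k, 0 ≤ w k) {A : WienerAlg B} {x : ℝ}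
    (h : WBound w A x) : WBound w (WienerAlg.diag (A 0)) x :=
  h.of_le' hw fun k => by
    by_cases hk : k = 0
    · simp [hk]
    · simpa [diag_apply, hk] using mul_nonneg (norm_nonneg _) (hw k)

theorem WBound.of_sub_one {w : Zd d → ℝ} (hw : ∀ k, 0 ≤ w k) {A : WienerAlg B} {x M : ℝ}
    (h : WBound w (A - 1) x) (hM : w 0 + x ≤ M) : WBound w A M := by
  have h1 := (WBound.diag hw (1 : B.Seq)).add hw h
  rw [← one_def, add_sub_cancel, norm_one, one_mul] at h1
  exact h1.mono hM

/-! ### The Newton step -/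

/-- `Q` (with inverse `P`) conjugates `D + T + diag X` to `D + E`, where `D` is the diagonal matrix
of `p`; if `D` and `T` are real, then so is everything else. -/
structure IsConj (p : Zd d → ℂ) (T Q P E : WienerAlg B) (X : B.Seq) : Prop where
  inv_mul : P * Q = 1
  mul_inv : Q * P = 1
  comm : IsComm p Q (-((T + diag X) * Q) + Q * E)
  real : (∀ i, (p i).im = 0) → IsReal T →
    IsReal Q ∧ IsReal P ∧ IsReal E ∧ ∀ i, (X i).im = 0

/-- With `F = E + P diag(y) Q` one has `(D + F)(1 + V) = (1 + V) D + F - trunc N F + F V`, because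
`[D, V] = -trunc N F`. Multiplying by `Z = (1 + V)⁻¹` yields the new error. -/
theorem IsConj.step {p : Zd d → ℂ} {T Q P E V Z : WienerAlg B} {X y : B.Seq} {N : ℝ}
    (h : IsConj p T Q P E X) (hy : y = -E 0)
    (hV : IsComm p V (trunc N (-(E + P * diag y * Q))))
    (hVZ : (1 + V) * Z = 1) (hZV : Z * (1 + V) = 1)
    (hreal : (∀ i, (p i).im = 0) → IsReal (-(E + P * diag y * Q)) → IsReal V ∧ IsReal Z) :
    IsConj p T (Q * (1 + V)) (Z * P)
      (Z * (E + P * diag y * Q - trunc N (E + P * diag y * Q) + (E + P * diag y * Q) * V))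
      (X + y) := by
  set F := E + P * diag y * Q with hF
  have hQF : Q * F = Q * E + diag y * Q := by
    rw [hF, mul_add, ← mul_assoc, ← mul_assoc, h.mul_inv, one_mul]
  refine ⟨?_, ?_, ?_, fun hp hT => ?_⟩
  · rw [mul_assoc, ← mul_assoc P, h.inv_mul, one_mul, hZV]
  · rw [mul_assoc, ← mul_assoc (1 + V), hVZ, one_mul, h.mul_inv]
  · have hc := h.comm.mul ((IsComm.one p).add hV)
    have h1 : Q * (1 + V) * (Z * (F - trunc N F + F * V)) =
        (Q * E + diag y * Q) * (1 + V) - Q * trunc N F := by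
      calc Q * (1 + V) * (Z * (F - trunc N F + F * V))
          = Q * (((1 + V) * Z) * (F - trunc N F + F * V)) := by simp only [mul_assoc]
        _ = (Q * F) * (1 + V) - Q * trunc N F := by rw [hVZ]; noncomm_ring
        _ = _ := by rw [hQF]
    rw [h1]
    convert hc using 1
    rw [trunc_neg, diag_add]
    noncomm_ring
  · obtain ⟨hQ, hP, hE, hX⟩ := h.real hp hT
    have hyr : ∀ i, (y i).im = 0 := fun i => by simp [hy, hE.apply 0 i]
    have hFr : IsReal F := hE.add ((hP.mul (IsReal.diag hyr)).mul hQ)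
    obtain ⟨hVr, hZr⟩ := hreal hp hFr.neg
    exact ⟨hQ.mul (IsReal.one.add hVr), hZr.mul hP,
      hZr.mul ((hFr.sub (hFr.trunc N)).add (hFr.mul hVr)), fun i => by simp [hX i, hyr i]⟩

/-- One step of the Newton iteration, with bounds in the weights `w` (for the present scale),
`w'` (for the next scale) and `ws` (fixed). -/
theorem IsConj.exists_step {τ γ : ℝ} (hτ : 0 ≤ τ) (hγ : 0 < γ) {p : Zd d → ℂ}
    (hp : IsDistal B τ γ p) {w w' ws : Zd d → ℝ} (hw : IsAlgWeight w) (hw' : IsAlgWeight w')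
    (hws : IsAlgWeight ws) (hle : ∀ k, w' k ≤ w k) {N t μ M : ℝ} (hN : 0 ≤ N) (ht0 : 0 ≤ t)
    (hμ0 : 0 ≤ μ)
    (ht : ∀ k, N < ‖k‖ → w' k ≤ t * w k) (hμ : ∀ k : Zd d, ‖k‖ ≤ N → ws k ≤ μ * w k)
    (hM : w 0 + 1 ≤ M) (hMs : ws 0 + 1 ≤ M)
    {T Q P E : WienerAlg B} {X : B.Seq} (h : IsConj p T Q P E X) {ρ e x : ℝ} (hρ : ρ ≤ 1)
    (hQ : WBound w (Q - 1) ρ) (hP : WBound w (P - 1) ρ) (hQs : WBound ws (Q - 1) 1)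
    (hPs : WBound ws (P - 1) 1) (hE : WBound w E e)
    (hx : γ⁻¹ * N ^ τ * ((1 + M ^ 2) * e) ≤ x) (hx1 : x ≤ 1 / 2) (hμx : μ * x ≤ 1 / 2) :
    ∃ (Q' P' E' : WienerAlg B) (X' : B.Seq), IsConj p T Q' P' E' X' ∧
      WBound w (Q' - Q) (M * x) ∧ WBound w (P' - P) (2 * x * M) ∧
      WBound ws (Q' - Q) (M * (μ * x)) ∧ WBound ws (P' - P) (2 * (μ * x) * M) ∧
      WBound w' E' (M * ((t * (1 + M ^ 2) + 2 * M * ρ + (1 + M ^ 2) * x) * e)) ∧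
      ‖X' - X‖ ≤ e := by
  have hw0 := hw.nonneg
  have hM1 : 1 ≤ M := by linarith [hw0 0]
  -- This correction would cancel the main diagonal exactly if `Q` and `P` were `1`.
  obtain ⟨y, hy⟩ : ∃ y : B.Seq, y = -E 0 := ⟨_, rfl⟩
  have hY : WBound w (diag y) e := by
    rw [hy, diag_neg]
    exact (hE.diagPart hw0).neg
  have hQM : WBound w Q M := hQ.of_sub_one hw0 (by linarith)
  have hPM : WBound w P M := hP.of_sub_one hw0 (by linarith)
  have hF : WBound w (E + P * diag y * Q) ((1 + M ^ 2) * e) :=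
    (hE.add hw0 (hw.mul (hw.mul hPM hY) hQM)).mono (by nlinarith)
  obtain ⟨V, hVc, hVb, hVN, hVr⟩ := exists_isComm_trunc hτ hγ hp (N := N) (-(E + P * diag y * Q))
  have hg : 0 ≤ γ⁻¹ * N ^ τ := by positivity
  have hV : WBound w V x := by
    refine (hF.of_le hw0 hg fun k => ?_).mono hx
    rcases hVb k with hk | hk
    · rw [← mul_assoc]
      rw [neg_apply, norm_neg] at hk
      exact mul_le_mul_of_nonneg_right hk (hw0 k)
    · rw [hk, norm_zero, zero_mul]
      have := hw0 k
      positivity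
  have hVs : WBound ws V (μ * x) := hV.of_le hws.nonneg hμ0 fun k => by
    rcases le_or_gt ‖k‖ N with hk | hk
    · rw [mul_left_comm]
      exact mul_le_mul_of_nonneg_left (hμ k hk) (norm_nonneg _)
    · rw [hVN k hk]
      simp
  have hV1 : ‖V‖ < 1 := ((hw.norm_le hV).trans hx1).trans_lt (by norm_num)
  have hZ : WBound w (invOneAdd V - 1) (2 * x) := hw.invOneAdd_sub_one hV hx1
  have hZs : WBound ws (invOneAdd V - 1) (2 * (μ * x)) := hws.invOneAdd_sub_one hVs hμx
  have hZM : WBound w (invOneAdd V) M := hZ.of_sub_one hw0 (by linarith)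
  have hQ' : Q * (1 + V) - Q = Q * V := by noncomm_ring
  have hP' : invOneAdd V * P - P = (invOneAdd V - 1) * P := by noncomm_ring
  refine ⟨_, _, _, _, h.step hy hVc (one_add_mul_invOneAdd hV1) (invOneAdd_mul_one_add hV1)
    fun hpr hFr => ⟨hVr hpr hFr, (hVr hpr hFr).invOneAdd hV1⟩, ?_, ?_, ?_, ?_, ?_, ?_⟩
  · rw [hQ']; exact hw.mul hQM hV
  · rw [hP']; exact hw.mul hZ hPM
  · rw [hQ']; exact hws.mul (hQs.of_sub_one hws.nonneg hMs) hVs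
  · rw [hP']; exact hws.mul hZs (hPs.of_sub_one hws.nonneg hMs)
  · refine hw'.mul (hZM.weight_mono hw'.nonneg hle) ?_
    set F := E + P * diag y * Q with hFdef
    -- Since `E 0 = -y`, the main diagonal of `F` is that of `P diag(y) Q - diag y`, which carries a
    -- factor `ρ` from `Q - 1` or `P - 1`.
    have hF0 : WBound w' (diag (F 0)) (2 * M * ρ * e) := by
      have h1 : F 0 = ((P - 1) * diag y * Q + diag y * (Q - 1)) 0 := by
        have h2 : (P - 1) * diag y * Q + diag y * (Q - 1) = P * diag y * Q - diag y := by
          noncomm_ring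
        rw [h2, hFdef, add_apply, sub_apply, diag_apply_zero, hy]
        abel
      rw [h1]
      refine (((((hw.mul (hw.mul hP hY) hQM).add hw0 (hw.mul hY hQ)).diagPart hw0).weight_mono
        hw'.nonneg hle).mono ?_)
      have : 0 ≤ (M - 1) * (ρ * e) := mul_nonneg (by linarith) (mul_nonneg hQ.1 hE.1)
      nlinarith
    -- Only diagonals with `|k| > N` remain, where the change of weight gains `t`.
    have hT : WBound w' (F - trunc N F - diag (F 0)) (t * ((1 + M ^ 2) * e)) := by
      refine hF.of_le hw'.nonneg ht0 fun k => ?_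
      simp only [sub_apply, trunc_apply, diag_apply]
      by_cases hk0 : k = 0
      · simp only [hk0, ne_eq, not_true_eq_false, false_and, if_false, if_true, sub_zero, sub_self,
          norm_zero, zero_mul]
        exact mul_nonneg ht0 (mul_nonneg (norm_nonneg _) (hw0 0))
      · by_cases hk : ‖k‖ ≤ N
        · simp only [hk0, hk, ne_eq, not_false_eq_true, and_self, if_true, if_false, sub_self,
            norm_zero, zero_mul]
          exact mul_nonneg ht0 (mul_nonneg (norm_nonneg _) (hw0 k))
        · simp only [hk0, hk, and_false, if_false, sub_zero]
          rw [mul_left_comm]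
          exact mul_le_mul_of_nonneg_left (ht k (not_le.1 hk)) (norm_nonneg _)
    have h1 : F - trunc N F + F * V = (F - trunc N F - diag (F 0)) + diag (F 0) + F * V := by
      abel
    rw [h1]
    refine ((hT.add hw'.nonneg hF0).add hw'.nonneg
      ((hw.mul hF hV).weight_mono hw'.nonneg hle)).mono (le_of_eq ?_)
    ring
  · rw [add_sub_cancel_left, hy, norm_neg]
    exact (norm_apply_le E 0).trans (hw.norm_le hE)

end WienerAlg

/-- Dependent choice along an invariant, recording the relation between consecutive states. -/
theorem exists_seq_of_step {σ : Type*} {P : ℕ → σ → Prop} {R : ℕ → σ → σ → Prop} {a : σ}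
    (h0 : P 0 a) (h : ∀ n a, P n a → ∃ b, P (n + 1) b ∧ R n a b) :
    ∃ u : ℕ → σ, u 0 = a ∧ ∀ n, P n (u n) ∧ R n (u n) (u (n + 1)) := by
  choose f hf using h
  let u : ∀ n, {a // P n a} := fun n =>
    Nat.rec ⟨a, h0⟩ (fun n b => ⟨f n b.1 b.2, (hf n b.1 b.2).1⟩) n
  exact ⟨fun n => (u n).1, rfl, fun n => ⟨(u n).2, (hf n (u n).1 (u n).2).2⟩⟩

/-! ### The iteration and its limit -/

namespace WienerAlg

variable {d : ℕ} {B : TIBanachAlgebra d}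

theorem norm_diag_le (a : B.Seq) : ‖diag a‖ ≤ ‖a‖ := by
  refine norm_le_of_sum_le _ fun s => ?_
  have h0 : ∀ k, k ≠ 0 → ‖diag a k‖ = 0 := fun k hk => by simp [diag_apply, hk]
  by_cases hs : (0 : Zd d) ∈ s
  · rw [Finset.sum_eq_single_of_mem 0 hs fun k _ hk => h0 k hk, diag_apply_zero]
  · rw [Finset.sum_eq_zero fun k hk => h0 k (by rintro rfl; exact hs hk)]
    exact norm_nonneg _

theorem norm_one_le : ‖(1 : WienerAlg B)‖ ≤ 1 := (norm_diag_le 1).trans_eq norm_one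

theorem continuous_diag : Continuous (diag : B.Seq → WienerAlg B) := by
  refine (LipschitzWith.of_dist_le_mul (K := 1) fun a b => ?_).continuous
  rw [dist_eq_norm, dist_eq_norm, ← diag_sub]
  exact (norm_diag_le _).trans_eq (one_mul _).symm

/-- `κ * (1 - r ^ n)` dominates the partial sums of the geometric increments, and stays below `κ`
for every `n`. -/
theorem WBound.telescope {w : Zd d → ℝ} (hw : ∀ k, 0 ≤ w k) {A A' : WienerAlg B}
    {κ r y c : ℝ} {n : ℕ} (hr : 0 ≤ r) (h : WBound w (A - 1) (κ * (1 - r ^ n)))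
    (h' : WBound w (A' - A) y) (hy : y ≤ c * r ^ n) (hc : c ≤ κ * (1 - r)) :
    WBound w (A' - 1) (κ * (1 - r ^ (n + 1))) := by
  rw [← sub_add_sub_cancel A' A 1, add_comm]
  refine (h.add hw h').mono ?_
  have := mul_le_mul_of_nonneg_right hc (pow_nonneg hr n)
  rw [pow_succ]
  linarith

/-- The Newton iteration. -/
theorem exists_isConj_seq {τ γ : ℝ} (hτ : 0 ≤ τ) (hγ : 0 < γ) {p : Zd d → ℂ}
    (hp : IsDistal B τ γ p) {w : ℕ → Zd d → ℝ} {ws : Zd d → ℝ} (hw : ∀ n, IsAlgWeight (w n))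
    (hws : IsAlgWeight ws) (hle : ∀ n k, w (n + 1) k ≤ w n k) {N μ x : ℕ → ℝ}
    {t M q r v κ e : ℝ} (hN : ∀ n, 0 ≤ N n) (ht0 : 0 ≤ t) (hμ0 : ∀ n, 0 ≤ μ n)
    (ht : ∀ n k, N n < ‖k‖ → w (n + 1) k ≤ t * w n k)
    (hμ : ∀ n (k : Zd d), ‖k‖ ≤ N n → ws k ≤ μ n * w n k)
    (hM : ∀ n, w n 0 + 1 ≤ M) (hMs : ws 0 + 1 ≤ M) (hr0 : 0 ≤ r) (hr1 : r < 1) (hv : v ≤ 1 / 2)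
    (hv0 : 0 ≤ v)
    (hx : ∀ n, γ⁻¹ * N n ^ τ * ((1 + M ^ 2) * (e * q ^ n)) ≤ x n)
    (hxv : ∀ n, x n ≤ v * r ^ n) (hμx : ∀ n, μ n * x n ≤ v * r ^ n)
    (hκ : 2 * M * v ≤ κ * (1 - r)) (hκ1 : κ ≤ 1)
    (hq : M * (t * (1 + M ^ 2) + 2 * M * κ + (1 + M ^ 2) * v) ≤ q) {T : WienerAlg B}
    (hT : WBound (w 0) T e) :
    ∃ (Q P E : ℕ → WienerAlg B) (X : ℕ → B.Seq), X 0 = 0 ∧ ∀ n,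
      IsConj p T (Q n) (P n) (E n) (X n) ∧ WBound (w n) (E n) (e * q ^ n) ∧
      WBound ws (Q n - 1) κ ∧ WBound ws (P n - 1) κ ∧
      ‖Q (n + 1) - Q n‖ ≤ 2 * M * v * r ^ n ∧ ‖P (n + 1) - P n‖ ≤ 2 * M * v * r ^ n ∧
      ‖X (n + 1) - X n‖ ≤ e * q ^ n := by
  have hM1 : 1 ≤ M := by linarith [hws.nonneg 0]
  have hMv : 0 ≤ M * v := mul_nonneg (by linarith) hv0
  have hκ0 : 0 ≤ κ := nonneg_of_mul_nonneg_left (b := 1 - r) (by linarith) (by linarith)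
  have hκn (n : ℕ) : κ * (1 - r ^ n) ≤ κ :=
    mul_le_of_le_one_right hκ0 (by linarith [pow_nonneg hr0 n])
  -- `Q - 1` and `P - 1` are controlled twice: in the current weight, in order to multiply with `E`,
  -- and in the fixed weight `ws`, for the regularity of the limit.
  let Inv : ℕ → WienerAlg B × WienerAlg B × WienerAlg B × B.Seq → Prop := fun n a =>
    IsConj p T a.1 a.2.1 a.2.2.1 a.2.2.2 ∧ WBound (w n) a.2.2.1 (e * q ^ n) ∧
      WBound (w n) (a.1 - 1) (κ * (1 - r ^ n)) ∧ WBound (w n) (a.2.1 - 1) (κ * (1 - r ^ n)) ∧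
      WBound ws (a.1 - 1) (κ * (1 - r ^ n)) ∧ WBound ws (a.2.1 - 1) (κ * (1 - r ^ n))
  let Rel : ℕ → WienerAlg B × WienerAlg B × WienerAlg B × B.Seq →
      WienerAlg B × WienerAlg B × WienerAlg B × B.Seq → Prop := fun n a b =>
    ‖b.1 - a.1‖ ≤ 2 * M * v * r ^ n ∧ ‖b.2.1 - a.2.1‖ ≤ 2 * M * v * r ^ n ∧
      ‖b.2.2.2 - a.2.2.2‖ ≤ e * q ^ n
  -- The iteration starts from the trivial conjugation, with the whole perturbation as error.
  have h0 : Inv 0 (1, 1, T, 0) := by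
    have hd0 : diag (0 : B.Seq) = 0 := ext fun k => by simp [diag_apply]
    refine ⟨⟨one_mul 1, one_mul 1, ?_, fun _ hT => ⟨IsReal.one, IsReal.one, hT, fun i => rfl⟩⟩,
      by simpa using hT, ?_⟩
    · have := IsComm.one (B := B) p
      simpa [hd0] using this
    · simpa using ⟨WBound.zero (B := B) (w 0), WBound.zero (B := B) ws⟩
  have hstep : ∀ n a, Inv n a → ∃ b, Inv (n + 1) b ∧ Rel n a b := by
    rintro n ⟨Q, P, E, X⟩ ⟨hC, hE, hQ, hP, hQs, hPs⟩
    have hvn : v * r ^ n ≤ 1 / 2 := (mul_le_of_le_one_right hv0 (pow_le_one₀ hr0 hr1.le)).trans hv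
    obtain ⟨Q', P', E', X', hC', hQ', hP', hQs', hPs', hE', hX'⟩ :=
      hC.exists_step hτ hγ hp (hw n) (hw (n + 1)) hws (hle n) (hN n) ht0 (hμ0 n) (ht n) (hμ n)
        (hM n) hMs ((hκn n).trans hκ1) hQ hP (hQs.mono ((hκn n).trans hκ1))
        (hPs.mono ((hκn n).trans hκ1)) hE (hx n) ((hxv n).trans hvn) ((hμx n).trans hvn)
    have b1 : M * x n ≤ 2 * M * v * r ^ n := by
      have h1 := mul_le_mul_of_nonneg_left (hxv n) (zero_le_one.trans hM1)
      have h2 := mul_nonneg hMv (pow_nonneg hr0 n)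
      linarith
    have b2 : 2 * x n * M ≤ 2 * M * v * r ^ n := by
      have h1 := mul_le_mul_of_nonneg_left (hxv n) (zero_le_one.trans hM1)
      linarith
    have b3 : M * (μ n * x n) ≤ 2 * M * v * r ^ n := by
      have h1 := mul_le_mul_of_nonneg_left (hμx n) (zero_le_one.trans hM1)
      have h2 := mul_nonneg hMv (pow_nonneg hr0 n)
      linarith
    have b4 : 2 * (μ n * x n) * M ≤ 2 * M * v * r ^ n := by
      have h1 := mul_le_mul_of_nonneg_left (hμx n) (zero_le_one.trans hM1)
      linarith
    refine ⟨(Q', P', E', X'), ⟨hC', hE'.mono ?_, ?_, ?_, ?_, ?_⟩, ?_, ?_, hX'⟩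
    · rw [← mul_assoc, show e * q ^ (n + 1) = q * (e * q ^ n) by ring]
      refine mul_le_mul_of_nonneg_right ((mul_le_mul_of_nonneg_left ?_ (by linarith)).trans hq) hE.1
      have h1 : v * r ^ n ≤ v := mul_le_of_le_one_right hv0 (pow_le_one₀ hr0 hr1.le)
      have h2 := mul_le_mul_of_nonneg_left (hκn n) (show 0 ≤ 2 * M by linarith)
      have h3 := mul_le_mul_of_nonneg_left ((hxv n).trans h1) (show 0 ≤ 1 + M ^ 2 by positivity)
      linarith
    · exact (hQ.telescope (hw n).nonneg hr0 hQ' b1 hκ).weight_mono (hw (n + 1)).nonneg (hle n)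
    · exact (hP.telescope (hw n).nonneg hr0 hP' b2 hκ).weight_mono (hw (n + 1)).nonneg (hle n)
    · exact hQs.telescope hws.nonneg hr0 hQs' b3 hκ
    · exact hPs.telescope hws.nonneg hr0 hPs' b4 hκ
    · exact ((hw n).norm_le hQ').trans b1
    · exact ((hw n).norm_le hP').trans b2
  obtain ⟨u, hu0, hu⟩ := exists_seq_of_step h0 hstep
  refine ⟨fun n => (u n).1, fun n => (u n).2.1, fun n => (u n).2.2.1, fun n => (u n).2.2.2,
    by simp [hu0], fun n => ?_⟩
  obtain ⟨⟨hC, hE, -, -, hQs, hPs⟩, hQ', hP', hX'⟩ := hu n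
  exact ⟨hC, hE, hQs.mono (hκn n), hPs.mono (hκn n), hQ', hP', hX'⟩

theorem exists_tendsto_of_le_geometric {E : Type*} [NormedAddCommGroup E] [CompleteSpace E]
    {u : ℕ → E} {c r : ℝ} (hr : r < 1) (h : ∀ n, ‖u (n + 1) - u n‖ ≤ c * r ^ n) :
    ∃ a, Tendsto u atTop (𝓝 a) ∧ ‖u 0 - a‖ ≤ c / (1 - r) := by
  have h' (n : ℕ) : dist (u n) (u (n + 1)) ≤ c * r ^ n := by
    rw [dist_comm, dist_eq_norm]
    exact h n
  obtain ⟨a, ha⟩ := cauchySeq_tendsto_of_complete (cauchySeq_of_le_geometric r c hr h')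
  exact ⟨a, ha, dist_eq_norm (u 0) a ▸ dist_le_of_le_geometric_of_tendsto₀ r c hr h' ha⟩

/-- The limit of the Newton iteration. -/
theorem exists_isConj_zero {τ γ : ℝ} (hτ : 0 ≤ τ) (hγ : 0 < γ) {p : Zd d → ℂ}
    (hp : IsDistal B τ γ p) {w : ℕ → Zd d → ℝ} {ws : Zd d → ℝ} (hw : ∀ n, IsAlgWeight (w n))
    (hws : IsAlgWeight ws) (hle : ∀ n k, w (n + 1) k ≤ w n k) {N μ x : ℕ → ℝ}
    {t M q r v κ e : ℝ} (hN : ∀ n, 0 ≤ N n) (ht0 : 0 ≤ t) (hμ0 : ∀ n, 0 ≤ μ n)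
    (ht : ∀ n k, N n < ‖k‖ → w (n + 1) k ≤ t * w n k)
    (hμ : ∀ n (k : Zd d), ‖k‖ ≤ N n → ws k ≤ μ n * w n k)
    (hM : ∀ n, w n 0 + 1 ≤ M) (hMs : ws 0 + 1 ≤ M) (hr0 : 0 ≤ r) (hr1 : r < 1) (hv : v ≤ 1 / 2)
    (hv0 : 0 ≤ v) (hq0 : 0 ≤ q) (hq1 : q < 1)
    (hx : ∀ n, γ⁻¹ * N n ^ τ * ((1 + M ^ 2) * (e * q ^ n)) ≤ x n)
    (hxv : ∀ n, x n ≤ v * r ^ n) (hμx : ∀ n, μ n * x n ≤ v * r ^ n)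
    (hκ : 2 * M * v ≤ κ * (1 - r)) (hκ1 : κ ≤ 1)
    (hq : M * (t * (1 + M ^ 2) + 2 * M * κ + (1 + M ^ 2) * v) ≤ q) {T : WienerAlg B}
    (hT : WBound (w 0) T e) :
    ∃ (Q P : WienerAlg B) (X : B.Seq), IsConj p T Q P 0 X ∧ WBound ws (Q - 1) κ ∧
      WBound ws (P - 1) κ ∧ ‖X‖ ≤ e / (1 - q) := by
  obtain ⟨Q, P, E, X, hX0, h⟩ := exists_isConj_seq hτ hγ hp hw hws hle hN ht0 hμ0 ht hμ hM hMs
    hr0 hr1 hv hv0 hx hxv hμx hκ hκ1 hq hT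
  obtain ⟨Ql, hQl, -⟩ := exists_tendsto_of_le_geometric hr1 fun n => (h n).2.2.2.2.1
  obtain ⟨Pl, hPl, -⟩ := exists_tendsto_of_le_geometric hr1 fun n => (h n).2.2.2.2.2.1
  obtain ⟨Xl, hXl, hXn⟩ := exists_tendsto_of_le_geometric hq1 fun n => (h n).2.2.2.2.2.2
  have hEl : Tendsto E atTop (𝓝 0) := by
    refine squeeze_zero_norm (a := fun n => e * q ^ n) (fun n => (hw n).norm_le (h n).2.1) ?_
    simpa using (tendsto_pow_atTop_nhds_zero_of_lt_one hq0 hq1).const_mul e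
  have hd : Tendsto (fun n => diag (X n)) atTop (𝓝 (diag Xl)) :=
    (continuous_diag.tendsto Xl).comp hXl
  refine ⟨Ql, Pl, Xl, ⟨?_, ?_, ?_, fun hpr hTr => ⟨?_, ?_, fun i j => by simp, fun i => ?_⟩⟩, ?_,
    ?_, ?_⟩
  · exact tendsto_nhds_unique (hPl.mul hQl) (tendsto_const_nhds.congr fun n => (h n).1.inv_mul.symm)
  · exact tendsto_nhds_unique (hQl.mul hPl) (tendsto_const_nhds.congr fun n => (h n).1.mul_inv.symm)
  · exact IsComm.of_tendsto hQl (((hd.const_add T).mul hQl).neg.add (hQl.mul hEl))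
      fun n => (h n).1.comm
  · exact IsReal.of_tendsto hQl fun n => ((h n).1.real hpr hTr).1
  · exact IsReal.of_tendsto hPl fun n => ((h n).1.real hpr hTr).2.1
  · exact tendsto_nhds_unique
      (((Complex.continuous_im.comp (Seq.continuous_apply i)).tendsto Xl).comp hXl)
      (tendsto_const_nhds.congr fun n => (((h n).1.real hpr hTr).2.2.2 i).symm)
  · exact WBound.of_tendsto (hQl.sub_const 1) tendsto_const_nhds fun n => (h n).2.2.1
  · exact WBound.of_tendsto (hPl.sub_const 1) tendsto_const_nhds fun n => (h n).2.2.2.1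
  · simpa [hX0] using hXn

end WienerAlg

/-! ### Scales and the choice of parameters -/

namespace WienerAlg

/-- The weight adapted to the scale with parameter `u`. -/
noncomputable def scaleWeight {d : ℕ} (α₀ β u : ℝ) (k : Zd d) : ℝ :=
  bracket k ^ α₀ + u * bracket k ^ β

section

variable {d : ℕ} {α₀ β u : ℝ}

theorem scaleWeight_zero : scaleWeight α₀ β u (0 : Zd d) = 1 + u := by simp [scaleWeight]

theorem bracket_rpow_le_scaleWeight (hu : 0 ≤ u) (k : Zd d) :
    bracket k ^ α₀ ≤ scaleWeight α₀ β u k :=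
  le_add_of_nonneg_right (mul_nonneg hu (Real.rpow_nonneg (bracket_pos k).le β))

theorem scaleWeight_add_le (h0 : 0 ≤ α₀) (hβ : α₀ ≤ β) (hu : 0 ≤ u) (k l : Zd d) :
    scaleWeight α₀ β u (k + l) ≤ 2 ^ β * (scaleWeight α₀ β u k + scaleWeight α₀ β u l) := by
  have h1 := bracket_rpow_add_le h0 hβ k l
  have h2 := mul_le_mul_of_nonneg_left (bracket_rpow_add_le (h0.trans hβ) le_rfl k l) hu
  simp only [scaleWeight]
  nlinarith

theorem scaleWeight_mono {u' : ℝ} (h : u' ≤ u) (k : Zd d) :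
    scaleWeight α₀ β u' k ≤ scaleWeight α₀ β u k :=
  add_le_add_right (mul_le_mul_of_nonneg_right h (Real.rpow_nonneg (bracket_pos k).le β)) _

/-- `N` is the crossover point at which `θ u ⟨k⟩^β` overtakes `⟨k⟩^α₀`. Beyond it the new weight is
at most twice its second term, which is `θ` times that of the old weight. -/
theorem scaleWeight_tail {θ N : ℝ} (hβ : α₀ ≤ β) (hθ : 0 ≤ θ) (hu : 0 ≤ u) (hN : 0 < N)
    (huN : θ * u * N ^ (β - α₀) = 1) {k : Zd d} (hk : N < ‖k‖) :
    scaleWeight α₀ β (θ * u) k ≤ 2 * θ * scaleWeight α₀ β u k := by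
  have h1 : N ^ (β - α₀) ≤ bracket k ^ (β - α₀) :=
    Real.rpow_le_rpow hN.le (hk.le.trans (norm_le_bracket k)) (sub_nonneg.2 hβ)
  have h2 : bracket k ^ β = bracket k ^ (β - α₀) * bracket k ^ α₀ := by
    rw [← Real.rpow_add (bracket_pos k), sub_add_cancel]
  have h3 := Real.rpow_nonneg (bracket_pos k).le α₀
  have h4 : bracket k ^ α₀ ≤ θ * u * bracket k ^ β := by
    rw [h2, ← mul_assoc]
    refine le_mul_of_one_le_left h3 ?_
    rw [← huN]
    exact mul_le_mul_of_nonneg_left h1 (mul_nonneg hθ hu)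
  simp only [scaleWeight]
  nlinarith [mul_nonneg hθ h3]

/-- Used for `V`, which is supported on `|k| ≤ N`: passing to order `s` costs only a power of `N`.
-/
theorem bracket_rpow_le_mul_scaleWeight {s N : ℝ} (hs : α₀ ≤ s) (hN : 1 ≤ N) (hu : 0 ≤ u)
    {k : Zd d} (hk : ‖k‖ ≤ N) : bracket k ^ s ≤ N ^ (s - α₀) * scaleWeight α₀ β u k := by
  have h1 : bracket k ^ (s - α₀) ≤ N ^ (s - α₀) :=
    Real.rpow_le_rpow (bracket_pos k).le (max_le hN hk) (sub_nonneg.2 hs)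
  have h2 : bracket k ^ s = bracket k ^ (s - α₀) * bracket k ^ α₀ := by
    rw [← Real.rpow_add (bracket_pos k), sub_add_cancel]
  rw [h2]
  exact mul_le_mul h1 (bracket_rpow_le_scaleWeight hu k)
    (Real.rpow_nonneg (bracket_pos k).le _) (Real.rpow_nonneg (by linarith) _)

end

/-- Conjugation of `D + T + diag X` to `D`, with quantitative bounds. -/
theorem exists_conj (d : ℕ) {δ α₀ τ α : ℝ} (hδ : 0 < δ) (hα₀ : (d : ℝ) / 2 < α₀) (hτ : 0 < τ)
    (hα : α₀ + τ + 7 * δ < α) :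
    ∃ c : ℝ, 1 ≤ c ∧ IsAlgWeight (fun k : Zd d => c * bracket k ^ (α - τ - 7 * δ)) ∧
    ∃ C : ℝ, 0 < C ∧ ∀ γ : ℝ, 0 < γ → ∃ K : ℝ, 0 < K ∧ ∃ ε₁ : ℝ, 0 < ε₁ ∧
      ∀ (B : TIBanachAlgebra d) (p : Zd d → ℂ), IsDistal B τ γ p →
      ∀ (T : WienerAlg B) (ε : ℝ), WBound (fun k => bracket k ^ (α + 4 * δ)) T ε → ε ≤ ε₁ →
      ∃ (Q P : WienerAlg B) (X : B.Seq), IsConj p T Q P 0 X ∧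
        WBound (fun k => c * bracket k ^ (α - τ - 7 * δ)) (Q - 1) (K * ε) ∧
        WBound (fun k => c * bracket k ^ (α - τ - 7 * δ)) (P - 1) (K * ε) ∧ ‖X‖ ≤ C * ε := by
  have hα₀0 : 0 < α₀ := lt_of_le_of_lt (by positivity) hα₀
  set β := α + 4 * δ with hβ
  set s := α - τ - 7 * δ with hs
  have hβα₀ : α₀ ≤ β := by linarith
  have hsα₀ : α₀ ≤ s := by linarith
  obtain ⟨c, hc1, hc⟩ := exists_isAlgWeight d hα₀ β (by linarith)
  have hws : IsAlgWeight (fun k : Zd d => c * bracket k ^ s) :=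
    hc (fun k => bracket k ^ s)
      (fun k => Real.rpow_le_rpow_of_exponent_le (one_le_bracket k) hsα₀)
      fun k l => bracket_rpow_add_le (by linarith) (by linarith) k l
  have hwu {u : ℝ} (hu : 0 ≤ u) : IsAlgWeight (fun k : Zd d => c * scaleWeight α₀ β u k) :=
    hc _ (bracket_rpow_le_scaleWeight hu) (scaleWeight_add_le hα₀0.le hβα₀ hu)
  set M : ℝ := 2 * c + 1 with hM
  set L : ℝ := 1 + M ^ 2 with hL
  have hM1 : 1 < M := by linarith
  have hL1 : 1 < L := by nlinarith
  have hML : 1 < 4 * M * L := by nlinarith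
  -- The gap `β - α = 4δ` pays for the constants: this `Λ` gives `θ * (4 * M * L) = q`, so the
  -- truncation tail contributes exactly `q / 2`.
  obtain ⟨Λ, hΛ1, hΛ⟩ : ∃ Λ : ℝ, 1 < Λ ∧ Λ ^ (4 * δ) = 4 * M * L :=
    ⟨(4 * M * L) ^ ((4 * δ)⁻¹), Real.one_lt_rpow hML (by positivity), by
      rw [← Real.rpow_mul (by linarith), inv_mul_cancel₀ (by positivity), Real.rpow_one]⟩
  have hΛ0 : 0 < Λ := by linarith
  set q : ℝ := Λ ^ (-(α - α₀)) with hq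
  set r : ℝ := Λ ^ (-(7 * δ)) with hr
  set θ : ℝ := Λ ^ (-(β - α₀)) with hθ
  have hq0 : 0 < q := Real.rpow_pos_of_pos hΛ0 _
  have hr0 : 0 < r := Real.rpow_pos_of_pos hΛ0 _
  have hθ0 : 0 < θ := Real.rpow_pos_of_pos hΛ0 _
  have hq1 : q < 1 := Real.rpow_lt_one_of_one_lt_of_neg hΛ1 (by linarith)
  have hr1 : r < 1 := Real.rpow_lt_one_of_one_lt_of_neg hΛ1 (by linarith)
  have hθ1 : θ < 1 := Real.rpow_lt_one_of_one_lt_of_neg hΛ1 (by linarith)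
  have hθq : θ * (4 * M * L) = q := by
    rw [← hΛ, hθ, hq, ← Real.rpow_add hΛ0]
    congr 1
    rw [hβ]
    ring
  -- Exponents: `(s - α₀) + τ - (α - α₀) = -7δ`. Passing to order `s`, the small divisors and the
  -- decay of the error balance to a convergent rate.
  have hrq : Λ ^ (s - α₀) * Λ ^ τ * q = r := by
    rw [hq, hr, ← Real.rpow_add hΛ0, ← Real.rpow_add hΛ0]
    congr 1
    rw [hs]
    ring
  set κ₀ : ℝ := 2 * M / (1 - r) with hκ₀
  have hκ₀0 : 0 < κ₀ := div_pos (by linarith) (by linarith)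
  set K₀ : ℝ := Λ ^ (s - α₀) * Λ ^ τ * L with hK₀
  have hK₀0 : 0 < K₀ := by positivity
  -- The three entries ensure, in order, the Neumann series for `(1 + V)⁻¹`, the bound `κ ≤ 1`, and
  -- that the residual diagonal and quadratic terms use up at most the other `q / 2`.
  set vm : ℝ := min (1 / 2) (min (1 / κ₀) (q / (2 * M * (2 * M * κ₀ + L)))) with hvm
  have hvm0 : 0 < vm := lt_min (by norm_num) (lt_min (by positivity) (by positivity))
  refine ⟨c, hc1, hws, 2 * c / (1 - q), div_pos (by linarith) (by linarith), fun γ hγ =>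
    ⟨κ₀ * (γ⁻¹ * K₀ * (2 * c)), by positivity, vm * γ / (2 * c * K₀), by positivity,
    fun B p hp T ε hT hε => ?_⟩⟩
  have hε0 : 0 ≤ ε := hT.1
  set e : ℝ := 2 * c * ε with he
  have he0 : 0 ≤ e := by positivity
  set v : ℝ := γ⁻¹ * K₀ * e with hv
  have hv0 : 0 ≤ v := by positivity
  have hvvm : v ≤ vm := by
    rw [le_div_iff₀ (by positivity)] at hε
    rw [hv, he, mul_assoc, inv_mul_le_iff₀ hγ]
    linarith
  have hv1 : v ≤ 1 / 2 := hvvm.trans (min_le_left _ _)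
  have hv2 : κ₀ * v ≤ 1 := by
    have := hvvm.trans ((min_le_right _ _).trans (min_le_left _ _))
    rw [le_div_iff₀ hκ₀0] at this
    linarith
  have hv3 : M * ((2 * M * κ₀ + L) * v) ≤ q / 2 := by
    have := hvvm.trans ((min_le_right _ _).trans (min_le_right _ _))
    rw [le_div_iff₀ (by positivity)] at this
    linarith
  have hpow (y : ℝ) (n : ℕ) : (Λ ^ n) ^ y = (Λ ^ y) ^ n := by
    rw [← Real.rpow_natCast, ← Real.rpow_natCast, ← Real.rpow_mul hΛ0.le, ← Real.rpow_mul hΛ0.le,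
      mul_comm]
  have hμx (n : ℕ) : (Λ ^ (n + 1)) ^ (s - α₀) * (γ⁻¹ * (Λ ^ (n + 1)) ^ τ * (L * (e * q ^ n))) =
      v * r ^ n := by
    rw [hpow, hpow, ← hrq, hv, hK₀, mul_pow, mul_pow, pow_succ, pow_succ]
    ring
  have hθn (n : ℕ) : 0 ≤ θ ^ n := pow_nonneg hθ0.le n
  have hθn1 (n : ℕ) : θ ^ n ≤ 1 := pow_le_one₀ hθ0.le hθ1.le
  -- The initial weight has `u = 1` and is at most `2 * c * ⟨k⟩^β`; hence `e = 2 * c * ε`.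
  have hT0 : WBound (fun k => c * scaleWeight α₀ β (θ ^ 0) k) T e := by
    refine hT.of_le (hwu (hθn 0)).nonneg (by linarith) fun k => ?_
    have h1 : bracket k ^ α₀ ≤ bracket k ^ β :=
      Real.rpow_le_rpow_of_exponent_le (one_le_bracket k) hβα₀
    have h2 : c * scaleWeight α₀ β (θ ^ 0) k ≤ 2 * c * bracket k ^ β := by
      simp only [scaleWeight, pow_zero, one_mul]
      nlinarith
    have := mul_le_mul_of_nonneg_left h2 (norm_nonneg (T k))
    linarith
  obtain ⟨Q, P, X, h, hQ, hP, hX⟩ := exists_isConj_zero hτ.le hγ hp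
    (w := fun n k => c * scaleWeight α₀ β (θ ^ n) k) (ws := fun k => c * bracket k ^ s)
    (fun n => hwu (hθn n)) hws
    (fun n k => mul_le_mul_of_nonneg_left
      (scaleWeight_mono (pow_le_pow_of_le_one hθ0.le hθ1.le n.le_succ) k) (by linarith))
    (N := fun n => Λ ^ (n + 1)) (μ := fun n => (Λ ^ (n + 1)) ^ (s - α₀))
    (x := fun n => γ⁻¹ * (Λ ^ (n + 1)) ^ τ * (L * (e * q ^ n)))
    (t := 2 * θ) (M := M) (q := q) (r := r) (v := v) (κ := κ₀ * v) (e := e)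
    (fun n => by positivity) (by positivity) (fun n => by positivity)
    (fun n k hk => by
      have h1 : θ * θ ^ n * (Λ ^ (n + 1)) ^ (β - α₀) = 1 := by
        rw [hpow, ← pow_succ', ← mul_pow, hθ, ← Real.rpow_add hΛ0]
        simp
      have := scaleWeight_tail hβα₀ hθ0.le (hθn n) (by positivity) h1 hk
      rw [pow_succ', mul_left_comm]
      exact mul_le_mul_of_nonneg_left this (by linarith))
    (fun n k hk => by
      rw [mul_left_comm]
      exact mul_le_mul_of_nonneg_left
        (bracket_rpow_le_mul_scaleWeight hsα₀ (one_le_pow₀ hΛ1.le) (hθn n) hk) (by linarith))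
    (fun n => by
      rw [scaleWeight_zero]
      nlinarith [hθn1 n])
    (by rw [bracket_zero, Real.one_rpow]; linarith) hr0.le hr1 hv1 hv0 hq0.le hq1
    (fun n => le_rfl)
    (fun n => by
      rw [← hμx]
      exact le_mul_of_one_le_left (by positivity)
        (Real.one_le_rpow (one_le_pow₀ hΛ1.le) (by linarith)))
    (fun n => (hμx n).le)
    (by
      rw [hκ₀, mul_right_comm (2 * M / (1 - r)), div_mul_cancel₀ _ (sub_pos.2 hr1).ne'])
    hv2
    (by
      have : M * (2 * θ * L) = q / 2 := by rw [← hθq]; ring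
      have h2 : M * (2 * θ * (1 + M ^ 2) + 2 * M * (κ₀ * v) + (1 + M ^ 2) * v) =
        M * (2 * θ * L) + M * ((2 * M * κ₀ + L) * v) := by rw [hL]; ring
      rw [h2]
      linarith)
    hT0
  have hK : κ₀ * v = κ₀ * (γ⁻¹ * K₀ * (2 * c)) * ε := by rw [hv, he]; ring
  rw [hK] at hQ hP
  refine ⟨Q, P, X, h, hQ, hP, hX.trans_eq ?_⟩
  rw [he]
  ring

/-! ### From commutators back to matrix products -/

variable {d : ℕ} {B : TIBanachAlgebra d}

/-- Although `D` is unbounded, `p k * Q k j = p j * Q k j - (K Q) k j` by the commutator relation.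
This makes the series for `P D Q` converge absolutely, with sum `(P Q) i j * p j - (P K Q) i j`. -/
theorem isMatProd₃_of_isComm {p : Zd d → ℂ} {K Q P : WienerAlg B} (hPQ : P * Q = 1)
    (h : IsComm p Q (-(K * Q))) :
    IsMatProd₃ (mat P) (mat K + Matrix.diagonal p) (mat Q) (Matrix.diagonal p) := fun i j => by
  have h1 := hasSum_mul₃_right P K Q i j
  have h2 : HasSum (fun k => mat P i k * p k * mat Q k j)
      (mat (1 : WienerAlg B) i j * p j - mat (P * (K * Q)) i j) := by
    rw [← hPQ]
    refine (((hasSum_mat_mul P Q i j).mul_right (p j)).sub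
      (hasSum_mat_mul P (K * Q) i j)).congr_fun fun k => ?_
    have h3 := h k j
    rw [mat_neg, Matrix.neg_apply] at h3
    linear_combination (mat P i k) * h3
  have hinj : Function.Injective fun k : Zd d => (k, k) := fun k l hkl => (Prod.ext_iff.1 hkl).1
  have h4 : HasSum (fun x : Zd d × Zd d => mat P i x.1 * Matrix.diagonal p x.1 x.2 * mat Q x.2 j)
      (mat (1 : WienerAlg B) i j * p j - mat (P * (K * Q)) i j) := by
    rw [← hinj.hasSum_iff]
    · simpa [Function.comp_def] using h2
    · rintro ⟨k, l⟩ hkl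
      have : k ≠ l := fun e => hkl ⟨k, by rw [e]⟩
      simp [Matrix.diagonal_apply_ne _ this]
  have h5 := h1.add h4
  rw [add_sub_cancel] at h5
  have h6 : mat (1 : WienerAlg B) i j * p j = Matrix.diagonal p i j := by
    by_cases hij : i = j <;> simp [hij]
  rw [h6] at h5
  refine h5.congr_fun fun x => ?_
  simp only [Matrix.add_apply]
  ring

/-! ### Transposition -/

/-- The transposed matrix. -/
noncomputable def tr (A : WienerAlg B) : WienerAlg B :=
  ofDiags (fun k => Seq.shiftHom k (A (-k))) <| by
    simpa [Function.comp_def] using (Equiv.neg (Zd d)).summable_iff.2 A.summable_norm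

theorem norm_tr_apply (A : WienerAlg B) (k : Zd d) : ‖tr A k‖ = ‖A (-k)‖ :=
  Seq.norm_shiftHom k _

theorem mat_tr_apply (A : WienerAlg B) (i j : Zd d) : mat (tr A) i j = mat A j i := by
  rw [mat_apply, tr, ofDiags_apply, Seq.shiftHom_apply, neg_sub, sub_sub_cancel, mat_apply]

theorem mat_tr (A : WienerAlg B) : mat (tr A) = (mat A)ᵀ := by
  ext i j
  exact mat_tr_apply A i j

theorem tr_mul (A A' : WienerAlg B) : tr (A * A') = tr A' * tr A :=
  (mul_eq_of_isMatProd fun i j => by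
    simp_rw [mat_tr_apply]
    exact (hasSum_mat_mul A A' j i).congr_fun fun k => mul_comm _ _).symm

theorem tr_sub (A A' : WienerAlg B) : tr (A - A') = tr A - tr A' :=
  mat_injective <| by
    ext i j
    simp [mat_tr_apply]

theorem tr_diag (a : B.Seq) : tr (diag a) = diag a :=
  mat_injective <| by rw [mat_tr, mat_diag, Matrix.diagonal_transpose]

theorem tr_add (A A' : WienerAlg B) : tr (A + A') = tr A + tr A' :=
  mat_injective <| by
    ext i j
    simp [mat_tr_apply]

theorem tr_one : tr (1 : WienerAlg B) = 1 := tr_diag 1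

theorem WBound.tr {w : Zd d → ℝ} (hw : ∀ k, w (-k) = w k) {A : WienerAlg B} {x : ℝ}
    (h : WBound w A x) : WBound w (tr A) x := by
  refine ⟨h.1, fun s => ?_⟩
  have := h.2 (s.map (Equiv.neg (Zd d)).toEmbedding)
  simpa [Finset.sum_map, norm_tr_apply, hw] using this

theorem IsComm.tr {p : Zd d → ℂ} {V F : WienerAlg B} (h : IsComm p V F) :
    IsComm p (tr V) (-tr F) := fun i j => by
  rw [mat_neg, Matrix.neg_apply, mat_tr_apply, mat_tr_apply, ← h]
  ring

theorem IsReal.tr {A : WienerAlg B} (h : IsReal A) : IsReal (tr A) := fun i j => by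
  rw [mat_tr_apply]
  exact h j i

theorem IsReal.conjTranspose {A : WienerAlg B} (h : IsReal A) : (mat A)ᴴ = mat (WienerAlg.tr A) := by
  ext i j
  rw [Matrix.conjTranspose_apply, mat_tr_apply]
  exact Complex.conj_eq_iff_im.2 (h j i)

/-- Distality makes the entries of `p` pairwise distinct, so whatever commutes with `D` is diagonal.
-/
theorem IsComm.eq_diag {τ γ : ℝ} {p : Zd d → ℂ} (hp : IsDistal B τ γ p) {G : WienerAlg B}
    (h : IsComm p G 0) : G = WienerAlg.diag (G 0) :=
  ext fun k => by
    rw [diag_apply]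
    split_ifs with hk
    · rw [hk]
    · refine Seq.ext fun i => ?_
      have h1 := h i (i - k)
      rw [mat_apply, sub_sub_cancel] at h1
      exact (mul_eq_zero.1 h1).resolve_left ((hp k hk).1 i)

theorem IsComm.diag (p : Zd d → ℂ) (a : B.Seq) : IsComm p (WienerAlg.diag a) 0 := fun i j => by
  by_cases h : i = j <;> simp [mat_diag, h]

end WienerAlg

/-! ### The inverse square root near `1` -/

/-- The equation reads `2 x = -(u + 2 x u + x² + x² u)`; it is solved by a contraction with constant
`1/2` on the ball of radius `2 ‖u‖`. -/
theorem exists_inv_sqrt {E : Type*} [NormedCommRing E] [NormedAlgebra ℂ E] [CompleteSpace E]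
    {u : E} (hu : ‖u‖ ≤ 1 / 8) :
    ∃ x : E, (1 + x) * (1 + x) * (1 + u) = 1 ∧ ‖x‖ ≤ 2 * ‖u‖ := by
  let Φ : E → E := fun x => (1 / 2 : ℂ) • (-(u + 2 * (x * u) + x * x + x * x * u))
  have h2 (y : E) : ‖(2 : E) * y‖ ≤ 2 * ‖y‖ := by
    rw [two_mul, two_mul]
    exact norm_add_le _ _
  have hhalf (y : E) : ‖(1 / 2 : ℂ) • y‖ = 1 / 2 * ‖y‖ := by rw [norm_smul]; norm_num
  have hu0 := norm_nonneg u
  have hmaps : Set.MapsTo Φ (Metric.closedBall 0 (2 * ‖u‖)) (Metric.closedBall 0 (2 * ‖u‖)) := by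
    intro x hx
    rw [mem_closedBall_zero_iff] at hx ⊢
    have h1 : ‖x * u‖ ≤ 2 * ‖u‖ * ‖u‖ :=
      (norm_mul_le _ _).trans (mul_le_mul_of_nonneg_right hx hu0)
    have h3 : ‖x * x‖ ≤ 2 * ‖u‖ * (2 * ‖u‖) :=
      (norm_mul_le _ _).trans (mul_le_mul hx hx (norm_nonneg _) (by positivity))
    have h4 : ‖x * x * u‖ ≤ 2 * ‖u‖ * (2 * ‖u‖) * ‖u‖ :=
      (norm_mul_le _ _).trans (mul_le_mul_of_nonneg_right h3 hu0)
    have h5 : ‖u + 2 * (x * u) + x * x + x * x * u‖ ≤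
        ‖u‖ + 2 * ‖x * u‖ + ‖x * x‖ + ‖x * x * u‖ :=
      (norm_add_le _ _).trans (add_le_add ((norm_add_le _ _).trans (add_le_add
        ((norm_add_le _ _).trans (add_le_add le_rfl (h2 _))) le_rfl)) le_rfl)
    simp only [Φ]
    rw [hhalf, norm_neg]
    nlinarith [mul_nonneg hu0 hu0, mul_nonneg (mul_nonneg hu0 hu0) hu0]
  have hlip : LipschitzWith (1 / 2) (hmaps.restrict Φ _ _) := by
    refine LipschitzWith.of_dist_le_mul fun x y => ?_
    obtain ⟨x, hx⟩ := x
    obtain ⟨y, hy⟩ := y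
    rw [mem_closedBall_zero_iff] at hx hy
    change dist (Φ x) (Φ y) ≤ _ * dist x y
    rw [dist_eq_norm, dist_eq_norm]
    have h1 : Φ x - Φ y = (1 / 2 : ℂ) • (-((x - y) * (2 * u + (x + y) + (x + y) * u))) := by
      simp only [Φ]
      rw [← smul_sub]
      congr 1
      ring
    have h3 : ‖x + y‖ ≤ 4 * ‖u‖ := (norm_add_le _ _).trans (by linarith)
    have h4 : ‖(x + y) * u‖ ≤ 4 * ‖u‖ * ‖u‖ :=
      (norm_mul_le _ _).trans (mul_le_mul_of_nonneg_right h3 hu0)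
    have h5 : ‖2 * u + (x + y) + (x + y) * u‖ ≤ 1 :=
      ((norm_add_le _ _).trans (add_le_add ((norm_add_le _ _).trans
        (add_le_add (h2 u) h3)) h4)).trans (by nlinarith)
    rw [h1, hhalf, norm_neg]
    have h6 := (norm_mul_le (x - y) (2 * u + (x + y) + (x + y) * u)).trans
      (mul_le_mul_of_nonneg_left h5 (norm_nonneg _))
    norm_num
    linarith
  obtain ⟨x, hx, hfix, -⟩ := ContractingWith.exists_fixedPoint'
    (Metric.isClosed_closedBall.isComplete) hmaps
    (K := 1 / 2) ⟨by norm_num, hlip⟩ (x := 0) (by simp) (edist_ne_top _ _)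
  refine ⟨x, ?_, mem_closedBall_zero_iff.1 hx⟩
  have h1 : x = (1 / 2 : ℂ) • (-(u + 2 * (x * u) + x * x + x * x * u)) := hfix.symm
  have h3 : (2 : E) * x = -(u + 2 * (x * u) + x * x + x * x * u) := by
    conv_lhs => rw [h1]
    rw [mul_smul_comm, two_mul, ← two_smul ℂ, smul_smul]
    norm_num
  linear_combination h3

/-! ### Polar decomposition in the real symmetric case -/

namespace WienerAlg

variable {d : ℕ} {B : TIBanachAlgebra d}

/-- Closeness to `1` makes the real parts of `r i` and `g i` positive. The imaginary part of `r² g =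
1`, with `g` real, then forces `r i` to be real. -/
theorem nonneg_of_sq_mul_eq_one {r g : B.Seq} (h : r * r * g = 1) (hr : ‖r - 1‖ < 1)
    (hg : ‖g - 1‖ < 1) (hgr : ∀ i, (g i).im = 0) (i : Zd d) : 0 ≤ r i := by
  have h1 : r i * r i * g i = 1 := congrArg (fun a : B.Seq => a i) h
  have h2 : 0 < (r i).re := by
    have := (Complex.abs_re_le_norm _).trans_lt ((Seq.norm_apply_le (r - 1) i).trans_lt hr)
    rw [Seq.sub_apply, Seq.one_apply, Complex.sub_re, Complex.one_re, abs_lt] at this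
    linarith
  have h3 : 0 < (g i).re := by
    have := (Complex.abs_re_le_norm _).trans_lt ((Seq.norm_apply_le (g - 1) i).trans_lt hg)
    rw [Seq.sub_apply, Seq.one_apply, Complex.sub_re, Complex.one_re, abs_lt] at this
    linarith
  have h4 := congrArg Complex.im h1
  simp only [Complex.mul_im, Complex.mul_re, hgr i, mul_zero, zero_add, Complex.one_im] at h4
  have h5 : (r i).im = 0 := by
    have : (r i).im * (2 * (r i).re * (g i).re) = 0 := by linarith
    exact (mul_eq_zero.1 this).resolve_right (by positivity)
  rw [Complex.le_def]
  exact ⟨h2.le, h5.symm⟩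

/-- The polar decomposition of a real conjugating matrix. -/
theorem IsConj.exists_polar {τ γ : ℝ} {p : Zd d → ℂ} (hp : IsDistal B τ γ p) {w : Zd d → ℝ}
    (hw : IsAlgWeight w) (heven : ∀ k, w (-k) = w k) {T Q P : WienerAlg B} {X : B.Seq}
    (h : IsConj p T Q P 0 X) (hpr : ∀ i, (p i).im = 0) (hTr : IsReal T) (hTs : tr T = T) {y : ℝ}
    (hQ : WBound w (Q - 1) y) (hy : y ≤ 1 / 24) :
    ∃ g r : B.Seq, tr Q * Q = diag g ∧ r * r * g = 1 ∧ (∀ i, 0 ≤ r i) ∧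
      WBound w (Q * diag r - 1) (8 * w 0 * y) ∧ IsReal (Q * diag r) ∧
      tr (Q * diag r) * (Q * diag r) = 1 ∧ Q * diag r * tr (Q * diag r) = 1 ∧
      IsComm p (Q * diag r) (-((T + diag X) * (Q * diag r))) := by
  have hy0 := hQ.1
  obtain ⟨hQr, -, -, -⟩ := h.real hpr hTr
  have hc : IsComm p Q (-((T + diag X) * Q)) := by simpa using h.comm
  have hK : tr (T + diag X) = T + diag X := by rw [tr_add, hTs, tr_diag]
  -- With `K = T + diag X` symmetric, transposing `[D, Q] = -K Q` gives `[D, Qᵗ] = Qᵗ K`, and the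
  -- two terms of the Leibniz rule cancel.
  have hG0 : IsComm p (tr Q * Q) 0 := by
    convert hc.tr.mul hc using 1
    have : tr (-((T + diag X) * Q)) = -(tr Q * (T + diag X)) := by
      rw [← zero_sub, tr_sub, tr_mul, hK, ← zero_sub]
      congr 1
    rw [this]
    noncomm_ring
  obtain ⟨g, hg⟩ : ∃ g, g = (tr Q * Q) 0 := ⟨_, rfl⟩
  have hG : tr Q * Q = diag g := hg ▸ hG0.eq_diag hp
  have hQ1 : ‖Q - 1‖ ≤ y := hw.norm_le hQ
  have htQ1 : ‖tr Q - 1‖ ≤ y := by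
    rw [← tr_one, ← tr_sub]
    exact hw.norm_le (hQ.tr heven)
  have hQn : ‖Q‖ ≤ 1 + y := by
    rw [← add_sub_cancel 1 Q]
    exact (norm_add_le _ _).trans (add_le_add norm_one_le hQ1)
  have hg1 : ‖g - 1‖ ≤ 3 * y := by
    have e : g - 1 = ((tr Q - 1) * Q + (Q - 1)) 0 := by
      have : (tr Q - 1) * Q + (Q - 1) = tr Q * Q - 1 := by noncomm_ring
      rw [this, sub_apply, one_apply_zero, hg]
    rw [e]
    refine (norm_apply_le _ 0).trans ((norm_add_le _ _).trans ?_)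
    have := (norm_mul_le (tr Q - 1) Q).trans (mul_le_mul htQ1 hQn (norm_nonneg _) hy0)
    nlinarith
  -- The bound `y ≤ 1 / 24` gives the required `‖g - 1‖ ≤ 3 * y ≤ 1 / 8`.
  obtain ⟨x, hx, hxn⟩ := exists_inv_sqrt (u := g - 1) (by linarith)
  obtain ⟨r, hr⟩ : ∃ r, r = 1 + x := ⟨_, rfl⟩
  rw [← hr, add_sub_cancel] at hx
  have hr1 : ‖r - 1‖ ≤ 6 * y := by
    rw [hr, add_sub_cancel_left]
    linarith
  have hgr : ∀ i, (g i).im = 0 := fun i => by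
    rw [hg]
    exact (hQr.tr.mul hQr).apply 0 i
  have hr0 : ∀ i, 0 ≤ r i := fun i =>
    nonneg_of_sq_mul_eq_one hx (by linarith) (by linarith) hgr i
  have hUr : IsReal (Q * diag r) :=
    hQr.mul (IsReal.diag fun i => ((Complex.le_def.1 (hr0 i)).2).symm)
  have htrU : tr (Q * diag r) = diag r * tr Q := by rw [tr_mul, tr_diag]
  -- `diag (r * r)` inverts `QᵗQ`, so this is a left inverse of `Q`; it equals `P` and thus also
  -- inverts on the right, whence `U Uᵗ = 1`.
  have hP : diag (r * r) * tr Q = P := by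
    calc diag (r * r) * tr Q = diag (r * r) * (tr Q * Q) * P := by
          rw [mul_assoc, mul_assoc, h.mul_inv, mul_one]
      _ = P := by rw [hG, ← diag_mul, hx, ← one_def, one_mul]
  refine ⟨g, r, hG, hx, hr0, ?_, hUr, ?_, ?_, ?_⟩
  · have e : Q * diag r - 1 = (Q - 1) * diag r + diag (r - 1) := by
      rw [diag_sub, ← one_def]
      noncomm_ring
    rw [e]
    refine ((hw.mul hQ (WBound.diag hw.nonneg r)).add hw.nonneg
      (WBound.diag hw.nonneg (r - 1))).mono ?_
    have hrn : ‖r‖ ≤ 2 := by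
      have := norm_add_le (1 : B.Seq) (r - 1)
      rw [add_sub_cancel, norm_one] at this
      linarith
    have h0 := hw.nonneg 0
    have h1 : y * (‖r‖ * w 0) ≤ y * (2 * w 0) :=
      mul_le_mul_of_nonneg_left (mul_le_mul_of_nonneg_right hrn h0) hy0
    have h2 := mul_le_mul_of_nonneg_right hr1 h0
    linarith
  · calc tr (Q * diag r) * (Q * diag r) = diag r * (tr Q * Q) * diag r := by
          rw [htrU]; simp only [mul_assoc]
      _ = diag (r * r * g) := by rw [hG, ← diag_mul, ← diag_mul]; congr 1; ring
      _ = 1 := by rw [hx, one_def]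
  · calc Q * diag r * tr (Q * diag r) = Q * (diag r * diag r * tr Q) := by
          rw [htrU]; simp only [mul_assoc]
      _ = 1 := by rw [← diag_mul, hP, h.mul_inv]
  · have := hc.mul (IsComm.diag p r)
    simpa [mul_assoc] using this

theorem isMatInv_mat {Q P : WienerAlg B} (h : P * Q = 1) (h' : Q * P = 1) :
    IsMatInv (mat Q) (mat P) :=
  ⟨by simpa [h] using isMatProd_mul P Q, by simpa [h'] using isMatProd_mul Q P⟩

theorem sobolev_of_sub_one {c s : ℝ} (hc : 1 ≤ c) {A : WienerAlg B} {x : ℝ}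
    (h : WBound (fun k => c * bracket k ^ s) (A - 1) x) :
    mat A ∈ MSpace B s ∧ sobNorm B s (mat A - 1) ≤ x := by
  have h0 : ∀ k : Zd d, 0 ≤ bracket k ^ s := fun k => Real.rpow_nonneg (bracket_pos k).le s
  have h1 : WBound (fun k => bracket k ^ s) (A - 1) x :=
    h.weight_mono h0 fun k => le_mul_of_one_le_left (h0 k) hc
  refine ⟨mat_mem_MSpace (h1.of_sub_one h0 le_rfl), ?_⟩
  rw [← mat_one (B := B), ← mat_sub]
  exact sobNorm_mat_le h1

/-- A large constant is absorbed by giving up part of the power of `ε`. This removes the dependence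
on `γ` from the constant of the theorem and puts it into the smallness threshold. -/
theorem mul_le_rpow_of_le {K ε ε₀ θ : ℝ} (hK : 0 < K) (hε : 0 ≤ ε) (hθ0 : 0 ≤ θ) (hθ1 : θ < 1)
    (h₀ : ε₀ = (1 / K) ^ (1 / (1 - θ))) (hle : ε ≤ ε₀) : K * ε ≤ ε ^ θ := by
  have h1 : 0 < 1 - θ := sub_pos.2 hθ1
  have h2 : ε ^ (1 - θ) ≤ 1 / K := by
    refine (Real.rpow_le_rpow hε hle h1.le).trans_eq ?_
    rw [h₀, ← Real.rpow_mul (by positivity), one_div_mul_cancel h1.ne', Real.rpow_one]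
  have h3 : ε = ε ^ (1 - θ) * ε ^ θ := by
    rw [← Real.rpow_add_of_nonneg hε h1.le hθ0, sub_add_cancel, Real.rpow_one]
  calc K * ε = K * ε ^ (1 - θ) * ε ^ θ := by rw [mul_assoc, ← h3]
    _ ≤ 1 * ε ^ θ := by
        refine mul_le_mul_of_nonneg_right ?_ (Real.rpow_nonneg hε θ)
        rw [le_div_iff₀ hK] at h2
        linarith
    _ = ε ^ θ := one_mul _

end WienerAlg

/-! ### Proof of the theorem -/

open WienerAlg in
theorem theorem2p1 (d : ℕ) (δ α₀ τ α : ℝ) (hδ : 0 < δ) (hα₀ : (d : ℝ) / 2 < α₀) (hτ : 0 < τ)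
    (hα : α₀ + τ + 7 * δ < α) :
    ∃ C : ℝ, 0 < C ∧ ∀ γ : ℝ, 0 < γ → ∃ ε₀ : ℝ, 0 < ε₀ ∧
      ∀ (B : TIBanachAlgebra d) (p : Zd d → ℂ), IsDistal B τ γ p →
      ∀ T ∈ MSpace B (α + 4 * δ), sobNorm B (α + 4 * δ) T ≤ ε₀ →
      ∃ Q ∈ MSpace B (α - τ - 7 * δ), ∃ Qinv ∈ MSpace B (α - τ - 7 * δ), ∃ D' ∈ MDiag B,
        IsMatInv Q Qinv ∧
        IsMatProd₃ Qinv (T + Matrix.diagonal p + D') Q (Matrix.diagonal p) ∧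
        sobNorm B (α - τ - 7 * δ) (Q - 1) ≤
          C * sobNorm B (α + 4 * δ) T ^ (δ / (α - α₀)) ∧
        sobNorm B (α - τ - 7 * δ) (Qinv - 1) ≤
          C * sobNorm B (α + 4 * δ) T ^ (δ / (α - α₀)) ∧
        sobNorm B 0 D' ≤ C * sobNorm B (α + 4 * δ) T ∧
        (1 ≤ α - α₀ → sobNorm B 0 D' ≤ C * sobNorm B (α + 4 * δ) T ^ (1 / (α - α₀))) ∧
        (IsRealSymm T → IsRealSymm (Matrix.diagonal p) →
          ∃ G : InfMat d, IsMatProd Qᵀ Q G ∧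
          ∃ R ∈ MSpace B (α - τ - 7 * δ), IsInvSqrt G R ∧
          ∃ U ∈ MSpace B (α - τ - 7 * δ), IsMatProd Q R U ∧
            IsUnitaryMat U ∧
            IsMatProd₃ Uᴴ (T + Matrix.diagonal p + D') U (Matrix.diagonal p) ∧
            sobNorm B (α - τ - 7 * δ) (U - 1) ≤
              C * sobNorm B (α + 4 * δ) T ^ (δ / (α - α₀))) := by
  obtain ⟨c, hc1, hws, C₁, hC₁, H⟩ := exists_conj d hδ hα₀ hτ hα
  -- `C₁` bounds the diagonal correction independently of `γ`; the added `1` covers the bounds on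
  -- `Q`, its inverse and `U`, which hold with constant `1` once `K` is absorbed.
  refine ⟨C₁ + 1, by linarith, fun γ hγ => ?_⟩
  obtain ⟨K, hK, ε₁, hε₁, H⟩ := H γ hγ
  have ha : 0 < α - α₀ := by linarith
  have hθ0 : 0 ≤ δ / (α - α₀) := by positivity
  have hθ1 : δ / (α - α₀) < 1 := by
    rw [div_lt_one ha]
    linarith
  have hK8 : 0 < 8 * c * K := by positivity
  -- The thresholds serve, in order, the iteration, the comparison of powers of `ε`, the polar
  -- decomposition, and the absorption of `8 * c * K`.
  refine ⟨min (min ε₁ 1) (min (1 / (24 * K)) ((1 / (8 * c * K)) ^ (1 / (1 - δ / (α - α₀))))),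
    lt_min (lt_min hε₁ one_pos) (lt_min (by positivity) (by positivity)),
    fun B p hp T hT hε => ?_⟩
  set ε := sobNorm B (α + 4 * δ) T with hεdef
  have hε0 : 0 ≤ ε := Real.sqrt_nonneg _
  have hε1 : ε ≤ ε₁ := hε.trans ((min_le_left _ _).trans (min_le_left _ _))
  have hε2 : ε ≤ 1 := hε.trans ((min_le_left _ _).trans (min_le_right _ _))
  have hε3 : K * ε ≤ 1 / 24 := by
    have := hε.trans ((min_le_right _ _).trans (min_le_left _ _))
    rw [le_div_iff₀ (by positivity)] at this
    linarith
  have hε4 : 8 * c * K * ε ≤ ε ^ (δ / (α - α₀)) :=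
    mul_le_rpow_of_le hK8 hε0 hθ0 hθ1 rfl (hε.trans ((min_le_right _ _).trans (min_le_right _ _)))
  have hKε : 0 ≤ K * ε := by positivity
  have hU : 8 * c * K * ε ≤ (C₁ + 1) * ε ^ (δ / (α - α₀)) :=
    hε4.trans (le_mul_of_one_le_left (Real.rpow_nonneg hε0 _) (by linarith))
  have hQb : K * ε ≤ (C₁ + 1) * ε ^ (δ / (α - α₀)) := le_trans (by nlinarith) hU
  obtain ⟨T', rfl, hT'⟩ := exists_mat_eq (s := α + 4 * δ) (by linarith) hT
  obtain ⟨Q, P, X, h, hQ, hP, hX⟩ := H B p hp T' ε hT' hε1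
  have hsum : mat T' + Matrix.diagonal p + mat (diag X) =
      mat (T' + diag X) + Matrix.diagonal p := by
    rw [mat_add]
    abel
  have hX0 : sobNorm B 0 (mat (diag X)) ≤ (C₁ + 1) * ε :=
    (sobNorm_mat_le (WBound.diag_bracket X 0)).trans (hX.trans (by linarith))
  refine ⟨mat Q, (sobolev_of_sub_one hc1 hQ).1, mat P, (sobolev_of_sub_one hc1 hP).1,
    mat (diag X), mat_diag_mem_MDiag X, isMatInv_mat h.inv_mul h.mul_inv, ?_,
    (sobolev_of_sub_one hc1 hQ).2.trans hQb, (sobolev_of_sub_one hc1 hP).2.trans hQb, hX0,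
    fun ha1 => hX0.trans ?_, fun hTs hps => ?_⟩
  · rw [hsum]
    exact isMatProd₃_of_isComm h.inv_mul (by simpa using h.comm)
  · refine mul_le_mul_of_nonneg_left ?_ (by linarith)
    rw [← Real.rpow_one ε]
    rw [← Real.rpow_mul hε0, one_mul]
    exact Real.rpow_le_rpow_of_exponent_ge_of_imp hε0 hε2 ((div_le_one ha).2 ha1)
      fun _ h0 => absurd h0 (by positivity)
  · have hpr : ∀ i, (p i).im = 0 := fun i => by simpa using hps.1 i i
    obtain ⟨g, r, hG, hrg, hr0, hUb, hUr, hU1, hU2, hUc⟩ :=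
      h.exists_polar hp hws (fun k => by rw [bracket_neg]) hpr hTs.1
        (mat_injective (by rw [mat_tr]; exact hTs.2)) hQ hε3
    have hUb' := hUb.mono (y := 8 * c * K * ε) (by
      rw [bracket_zero, Real.one_rpow]
      linarith)
    refine ⟨mat (diag g), by rw [← mat_tr, ← hG]; exact isMatProd_mul _ _, mat (diag r),
      mat_mem_MSpace (WBound.diag_bracket r _), ⟨?_, mat (diag (r * r)), ?_, ?_⟩,
      mat (Q * diag r), (sobolev_of_sub_one hc1 hUb').1, isMatProd_mul _ _, ?_, ?_,
      (sobolev_of_sub_one hc1 hUb').2.trans hU⟩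
    · rw [mat_diag]
      exact Matrix.PosSemidef.diagonal hr0
    · rw [diag_mul]
      exact isMatProd_mul _ _
    · refine isMatInv_mat ?_ ?_
      · rw [← diag_mul, hrg, one_def]
      · rw [← diag_mul, mul_comm, hrg, one_def]
    · rw [IsUnitaryMat, hUr.conjTranspose]
      exact isMatInv_mat hU1 hU2
    · rw [hsum, hUr.conjTranspose]
      exact isMatProd₃_of_isComm hU1 hUc
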